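/- Let $0<q<1/2$, $p=1-q$, $\lambda=q/p$, let $\tau_0,b>0$ and $v\in\mathbb R$, and let $z\ge 1$ and $A\ge z$ be integers. Honest miners and an attacker discover blocks; the times between successive blocks of the honest miners (resp. of the attacker) are exponential random variables of rate $p/\tau_0$ (resp. $q/\tau_0$), and all of them are independent. So the numbers $N(t)$, $N'(t)$ of blocks discovered up to time $t$ are independent Poisson processes. A cycle of the $(A,1)$-Nakamoto double spend strategy starts at time $0$. The attacker first mines on top of the official blockchain (restarting on its new last block whenever the honest miners find one) until the time $S'_1$ of his first block; he keeps this block secret, sends the purchasing transaction and goes on mining on his secret fork. For $t\ge S'_1$ the official blockchain has since gained $H(t)=N(t)-N(S'_1)$ blocks and the secret fork has $F(t)=1+N'(t)-N'(S'_1)$ blocks. The cycle ends at the first time $\mathbf T_A\ge S'_1$ at which either $H-F\ge A$ (the attacker gives up), or $H\ge z$ and $F>H$ (success). The revenue $\mathbf R_A$ is $v+b\,F(\mathbf T_A)$ after a success and $0$ otherwise, $P_A(z)$ is the probability of success, and $\Gamma_A=\mathbb E[\mathbf R_A]/\mathbb E[\mathbf T_A]$ is the revenue ratio. Write $[n]=\frac{1-\lambda^n}{1-\lambda}$,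 $B(a,b)=\frac{\Gamma(a)\Gamma(b)}{\Gamma(a+b)}$ and $I_x(a,b)=\frac{\Gamma(a+b)}{\Gamma(a)\Gamma(b)}\int_0^x t^{a-1}(1-t)^{b-1}\,dt$. Then the cycle ends almost surely, $\mathbf R_A$ and $\mathbf T_A$ are integrable, $\mathbb E[\mathbf T_A]>0$, $$P_A(z)=\frac{I_{4pq}(z,1/2)-\lambda^{A+1}}{1-\lambda^{A+1}},$$ $$\frac{\mathbb E[\mathbf R_A]}{b}=\frac{qz}{2p}I_{4pq}(z,1/2)-\frac{(A+1)\lambda^{A+1}}{p(1-\lambda)^3[A+1]^2}I_{(p-q)^2}(1/2,z)+\frac{2-\lambda+\lambda^{A+2}}{(1-\lambda)^2[A+1]}\,\frac{p^{z-1}q^z}{B(z,z)}+P_A(z)\left(\frac vb+1\right),$$ $$\frac{\mathbb E[\mathbf T_A]}{\tau_0}=\frac{z}{2p}I_{4pq}(z,1/2)+\frac{A+1}{p(1-\lambda)^2[A+1]}I_{(p-q)^2}(1/2,z)-\frac{p^{z-1}q^z}{p(1-\lambda)B(z,z)}+\frac1q,$$ and $\Gamma_A$ equals $b/\tau_0$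 times the quotient of the last two right-hand sides. -/

import Mathlib

open MeasureTheory ProbabilityTheory

/-- The regularized incomplete Beta function
`I_x(a,b) = Γ(a+b) / (Γ(a) Γ(b)) ∫₀ˣ t^(a-1) (1-t)^(b-1) dt`. -/
noncomputable def regIncBeta (x a b : ℝ) : ℝ :=
  Real.Gamma (a + b) / (Real.Gamma a * Real.Gamma b) *
    ∫ t in (0 : ℝ)..x, t ^ (a - 1) * (1 - t) ^ (b - 1)

/-- The notation `[n] = (1 - λ^n) / (1 - λ)`. -/
noncomputable def lamBracket (lam : ℝ) (n : ℕ) : ℝ := (1 - lam ^ n) / (1 - lam)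

namespace Nakamoto

variable {Ω : Type*}

/-- The mining model. `X i` is the time that the honest miners need for their `(i+1)`-th block
after their `i`-th one, and `Y i` is the same for the attacker.  All these times are independent;
those of the honest miners are exponential of rate `p / τ₀`, those of the attacker exponential of
rate `q / τ₀`.  Equivalently, the numbers of blocks mined up to time `t` by the two sides are two
independent Poisson processes of rates `p / τ₀` and `q / τ₀`. -/
structure IsMiningRace [MeasurableSpace Ω] (μ : Measure Ω) (p q τ₀ : ℝ)
    (X Y : ℕ → Ω → ℝ) : Prop where
  honest_law : ∀ i, HasLaw (X i) (expMeasure (p / τ₀)) μ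
  attacker_law : ∀ i, HasLaw (Y i) (expMeasure (q / τ₀)) μ
  indep : iIndepFun (Sum.elim X Y) μ

/-- The time at which the `n`-th block is discovered (`0` for `n = 0`), given the times between
successive blocks. For the honest miners this is `S_n`, for the attacker `S'_n`. -/
noncomputable def discoveryTime (X : ℕ → Ω → ℝ) (n : ℕ) (ω : Ω) : ℝ :=
  ∑ i ∈ Finset.range n, X i ω

/-- The number of blocks discovered up to time `t`: the number of `n ≥ 1` such that the `n`-th
block is discovered at the latest at time `t`. For the honest miners this is `N(t)`, for the
attacker `N'(t)`. -/
noncomputable def blockCount (X : ℕ → Ω → ℝ) (t : ℝ) (ω : Ω) : ℕ :=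
  {n : ℕ | discoveryTime X (n + 1) ω ≤ t}.ncard

/-- The end of the pre-mining phase. The attacker mines on the last block of the official
blockchain, restarting on the new last block whenever the honest miners find one first; with one
block to pre-mine, the phase ends when the attacker discovers his first block. -/
noncomputable def launchTime (Y : ℕ → Ω → ℝ) (ω : Ω) : ℝ := discoveryTime Y 1 ω

/-- The number of blocks added to the official blockchain between the launch of the attack and
time `t`; these are the confirmations of the vendor's transaction. -/
noncomputable def confirmations (X Y : ℕ → Ω → ℝ) (t : ℝ) (ω : Ω) : ℤ :=
  (blockCount X t ω : ℤ) - blockCount X (launchTime Y ω) ω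

/-- The length of the secret fork at time `t`: the pre-mined block and the blocks discovered by
the attacker since the launch of the attack. -/
noncomputable def secretFork (Y : ℕ → Ω → ℝ) (t : ℝ) (ω : Ω) : ℤ :=
  1 + ((blockCount Y t ω : ℤ) - blockCount Y (launchTime Y ω) ω)

/-- The lag of the secret fork behind the official blockchain, both being counted from the block
on which the fork was started. -/
noncomputable def lag (X Y : ℕ → Ω → ℝ) (t : ℝ) (ω : Ω) : ℤ :=
  confirmations X Y t ω - secretFork Y t ω

/-- At time `t` the attacker lags by `A` (or more) blocks, and gives up. -/
def GivesUpAt (A : ℕ) (X Y : ℕ → Ω → ℝ) (t : ℝ) (ω : Ω) : Prop :=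
  (A : ℤ) ≤ lag X Y t ω

/-- At time `t` the vendor's transaction has its `z` confirmations and the secret fork is longer
than the official blockchain, so that the attacker can release it with success. -/
def SucceedsAt (z : ℕ) (X Y : ℕ → Ω → ℝ) (t : ℝ) (ω : Ω) : Prop :=
  (z : ℤ) ≤ confirmations X Y t ω ∧ lag X Y t ω < 0

/-- The times after the launch at which a condition that ends the attack cycle of the
`(A,1)`-Nakamoto double spend strategy is fulfilled. -/
def endingTimes (A z : ℕ) (X Y : ℕ → Ω → ℝ) (ω : Ω) : Set ℝ :=
  {t | launchTime Y ω ≤ t ∧ (GivesUpAt A X Y t ω ∨ SucceedsAt z X Y t ω)}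

/-- The duration `T_A` of an attack cycle (it starts at time `0`, with the pre-mining). -/
noncomputable def cycleDuration (A z : ℕ) (X Y : ℕ → Ω → ℝ) (ω : Ω) : ℝ :=
  sInf (endingTimes A z X Y ω)

/-- The attack cycle ends with a successful double spend. -/
def IsSuccess (A z : ℕ) (X Y : ℕ → Ω → ℝ) (ω : Ω) : Prop :=
  SucceedsAt z X Y (cycleDuration A z X Y ω) ω

open Classical in
/-- The revenue `R_A` of an attack cycle: after a success the double spend amount `v` and the
reward `b` of every block of the attacker's fork (the pre-mined one included), otherwise `0`. -/
noncomputable def revenue (A z : ℕ) (v b : ℝ) (X Y : ℕ → Ω → ℝ) (ω : Ω) : ℝ :=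
  if IsSuccess A z X Y ω then v + b * (secretFork Y (cycleDuration A z X Y ω) ω : ℝ) else 0

/-- The probability of success `P_A(z)` of the attack. -/
noncomputable def successProb [MeasurableSpace Ω] (μ : Measure Ω) (A z : ℕ)
    (X Y : ℕ → Ω → ℝ) : ℝ :=
  μ.real {ω | IsSuccess A z X Y ω}

/-- The revenue ratio `Γ_A = E[R_A] / E[T_A]`. -/
noncomputable def revenueRatio [MeasurableSpace Ω] (μ : Measure Ω) (A z : ℕ) (v b : ℝ)
    (X Y : ℕ → Ω → ℝ) : ℝ :=
  (∫ ω, revenue A z v b X Y ω ∂μ) / ∫ ω, cycleDuration A z X Y ω ∂μ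

end Nakamoto

/-! Seen at the successive block times, the cycle is a Markov chain. By the memoryless property
(`lintegral_renewal`), the time to the next block has mean `τ₀` and is independent of its miner (an
honest one with probability `p`), and what remains is a fresh copy of the race. Once the attack is
launched, the state is the pair (confirmations `h`, fork length `f`).

Charge `c` per unit of time and pay a reward at the end. The expected total solves a linear one-step
equation. Conversely, every solution that grows at most linearly in `f` is this expectation:
truncating the game after `n` blocks costs at most a multiple of `ρ ^ n` with `ρ < 1`, because of
the function in `exists_lyapunov`, and monotone convergence lets `n` tend to infinity
(`lintegral_iSup_payoff`, `integral_cycle`).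

An explicit solution is `cycleValue`. Since `z ≤ A`, the attacker does not give up before the `z`-th
confirmation, and the number of his blocks by then is negative binomial. A fork that is not ahead at
that moment plays gambler's ruin with odds `λ` between the lacks `0` and `A + 1`. As `p^z q^k
λ^(z-k) = q^z p^k`, averaging the ruin formulas leaves only two negative binomial distribution
functions and their truncated means (`confirmMean_eq`, `sum_mul_negBin_eq`). These two functions add
up to 1, and the substitution `t = 4u(1-u)` turns twice one of them into `I_{4pq}(z, 1/2)`
(`regIncBeta_eq_negBinSum`). The rewards `1` and `f` and the charge for time then give the success
probability, the revenue and the duration. -/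

open scoped ENNReal

namespace Nakamoto

/-! ### Exponential laws: mean, memorylessness, change of rate. -/

section Exponential

variable {r s : ℝ}

lemma lintegral_expMeasure {g : ℝ → ℝ≥0∞} (hg : Measurable g) :
    ∫⁻ x, g x ∂(expMeasure r) =
      ∫⁻ x in Set.Ici 0, ENNReal.ofReal (r * Real.exp (-(r * x))) * g x := by
  have hm : Measurable (gammaPDF 1 r) := (measurable_gammaPDFReal 1 r).ennreal_ofReal
  rw [expMeasure, gammaMeasure, lintegral_withDensity_eq_lintegral_mul _ hm hg,
    ← lintegral_indicator measurableSet_Ici]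
  refine lintegral_congr fun x => ?_
  by_cases hx : 0 ≤ x
  · simp [gammaPDF_of_nonneg hx, hx]
  · simp [gammaPDF_of_neg (not_le.mp hx), hx]

/-- Multiplying the exponential density by `x` gives `1 / r` times the Gamma density of shape 2,
whose mass is 1. -/
lemma lintegral_id_expMeasure (hr : 0 < r) :
    ∫⁻ x, ENNReal.ofReal x ∂(expMeasure r) = ENNReal.ofReal (1 / r) := by
  have h2 := lintegral_gammaPDF_eq_one (a := 2) (r := r) two_pos hr
  have hm : Measurable (gammaPDF 2 r) := (measurable_gammaPDFReal 2 r).ennreal_ofReal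
  have key : ∀ x, (Set.Ici (0 : ℝ)).indicator
      (fun x => ENNReal.ofReal (r * Real.exp (-(r * x))) * ENNReal.ofReal x) x
      = ENNReal.ofReal (1 / r) * gammaPDF 2 r x := by
    intro x
    by_cases hx : 0 ≤ x
    · rw [Set.indicator_of_mem (Set.mem_Ici.mpr hx), gammaPDF_of_nonneg hx,
        ← ENNReal.ofReal_mul (by positivity), ← ENNReal.ofReal_mul (by positivity)]
      congr 1
      norm_num
      field_simp
    · rw [Set.indicator_of_notMem (by simpa using hx), gammaPDF_of_neg (not_le.mp hx), mul_zero]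
  rw [lintegral_expMeasure ENNReal.measurable_ofReal, ← lintegral_indicator measurableSet_Ici]
  simp_rw [key]
  rw [lintegral_const_mul _ hm, h2, mul_one]

lemma expMeasure_nonpos (r : ℝ) : expMeasure r (Set.Iic 0) = 0 := by
  rw [← lintegral_indicator_one measurableSet_Iic,
    lintegral_expMeasure (measurable_one.indicator measurableSet_Iic),
    setLIntegral_congr Ioi_ae_eq_Ici.symm,
    setLIntegral_congr_fun (g := fun _ => 0) measurableSet_Ioi]
  · simp
  · intro x hx
    simp [Set.mem_Ioi.mp hx]

lemma expMeasure_singleton (r c : ℝ) : expMeasure r {c} = 0 :=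
  withDensity_absolutelyContinuous _ _ (Real.volume_singleton)

/-- The memoryless property of the exponential distribution. -/
lemma lintegral_expMeasure_memoryless {h : ℝ → ℝ≥0∞} (hh : Measurable h) {u : ℝ} (hu : 0 ≤ u) :
    ∫⁻ w, (Set.Ioi u).indicator (fun w => h (w - u)) w ∂(expMeasure r) =
      ENNReal.ofReal (Real.exp (-(r * u))) * ∫⁻ w, h w ∂(expMeasure r) := by
  have hm : Measurable fun x => ENNReal.ofReal (r * Real.exp (-(r * x))) := by fun_prop
  rw [lintegral_expMeasure (g := (Set.Ioi u).indicator fun w => h (w - u))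
      ((hh.comp (measurable_id.sub_const u)).indicator measurableSet_Ioi),
    lintegral_expMeasure hh, ← lintegral_const_mul _ (by fun_prop),
    setLIntegral_congr (Ioi_ae_eq_Ici (a := (0 : ℝ))).symm,
    setLIntegral_congr (Ioi_ae_eq_Ici (a := (0 : ℝ))).symm,
    ← lintegral_indicator measurableSet_Ioi, ← lintegral_indicator measurableSet_Ioi,
    ← lintegral_add_right_eq_self _ u]
  refine lintegral_congr fun x => ?_
  by_cases hx : 0 < x
  · have h1 : 0 < x + u := by linarith
    rw [Set.indicator_of_mem (Set.mem_Ioi.mpr h1), Set.indicator_of_mem (Set.mem_Ioi.mpr hx),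
      Set.indicator_of_mem (by simpa using hx), add_sub_cancel_right, ← mul_assoc,
      ← ENNReal.ofReal_mul (by positivity)]
    congr 2
    rw [mul_add, neg_add, Real.exp_add]
    ring
  · rw [Set.indicator_of_notMem (s := Set.Ioi 0) (a := x) (by simpa using hx)]
    by_cases h1 : 0 < x + u
    · rw [Set.indicator_of_mem (Set.mem_Ioi.mpr h1), Set.indicator_of_notMem (by simpa using hx),
        mul_zero]
    · rw [Set.indicator_of_notMem (by simpa using h1)]

/-- The weight `exp (-(s * u))` is the probability that a competing clock of rate `s` has not rung
by time `u`; it turns the density of rate `r` into a multiple of that of rate `r + s`. -/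
lemma lintegral_expMeasure_tilt (hr : 0 < r) (hs : 0 < s) {g : ℝ → ℝ≥0∞} (hg : Measurable g) :
    ∫⁻ u, g u * ENNReal.ofReal (Real.exp (-(s * u))) ∂(expMeasure r) =
      ENNReal.ofReal (r / (r + s)) * ∫⁻ u, g u ∂(expMeasure (r + s)) := by
  have hm : Measurable fun x => ENNReal.ofReal ((r + s) * Real.exp (-((r + s) * x))) := by fun_prop
  rw [lintegral_expMeasure (by fun_prop), lintegral_expMeasure hg,
    ← lintegral_const_mul _ (by fun_prop)]
  refine lintegral_congr fun x => ?_
  rw [mul_left_comm, mul_comm, ← ENNReal.ofReal_mul (by positivity), ← mul_assoc,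
    ← ENNReal.ofReal_mul (by positivity)]
  congr 2
  have : Real.exp (-((r + s) * x)) = Real.exp (-(r * x)) * Real.exp (-(s * x)) := by
    rw [← Real.exp_add]
    congr 1
    ring
  rw [this]
  field_simp

end Exponential

/-! ### Sequences of independent exponential times. -/

section Sequences

/-- The sequence with first term `u`, followed by the terms of `x`. -/
def seqCons (u : ℝ) (x : ℕ → ℝ) : ℕ → ℝ
  | 0 => u
  | n + 1 => x n

/-- The sequence without its first term. -/
def seqTail (x : ℕ → ℝ) : ℕ → ℝ := fun n => x (n + 1)

@[simp] lemma seqCons_zero (u : ℝ) (x : ℕ → ℝ) : seqCons u x 0 = u := rfl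

@[simp] lemma seqCons_succ (u : ℝ) (x : ℕ → ℝ) (n : ℕ) : seqCons u x (n + 1) = x n := rfl

lemma measurable_seqTail : Measurable seqTail :=
  measurable_pi_iff.mpr fun n => measurable_pi_apply (n + 1)

lemma measurable_seqCons : Measurable fun a : ℝ × (ℕ → ℝ) => seqCons a.1 a.2 := by
  refine measurable_pi_iff.mpr fun n => ?_
  cases n with
  | zero => exact measurable_fst
  | succ n => exact (measurable_pi_apply n).comp measurable_snd

/-- The law of a sequence of independent exponential random variables of rate `r`. -/
noncomputable def expSeq (r : ℝ) : Measure (ℕ → ℝ) := Measure.infinitePi fun _ => expMeasure r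

lemma isProbabilityMeasure_expSeq {r : ℝ} (hr : 0 < r) : IsProbabilityMeasure (expSeq r) := by
  have := isProbabilityMeasure_expMeasure hr
  unfold expSeq
  infer_instance

lemma map_seqCons {r : ℝ} (hr : 0 < r) :
    ((expMeasure r).prod (expSeq r)).map (fun a => seqCons a.1 a.2) = expSeq r := by
  have := isProbabilityMeasure_expMeasure hr
  have := isProbabilityMeasure_expSeq hr
  refine Measure.eq_infinitePi _ fun s t ht => ?_
  classical
  -- The coordinates of the cylinder other than `0`, renumbered for the tail.
  set s' : Finset ℕ := (s.erase 0).image Nat.pred with hs'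
  have hpre : (fun a : ℝ × (ℕ → ℝ) => seqCons a.1 a.2) ⁻¹' (Set.pi s t) =
      (if 0 ∈ s then t 0 else Set.univ) ×ˢ (Set.pi s' fun n => t (n + 1)) := by
    ext ⟨u, x⟩
    simp only [Set.mem_preimage, Set.mem_pi, Set.mem_prod, Finset.mem_coe]
    constructor
    · intro h
      refine ⟨?_, ?_⟩
      · split_ifs with h0
        · exact h 0 h0
        · trivial
      · intro n hn
        rw [hs', Finset.mem_image] at hn
        obtain ⟨m, hm, rfl⟩ := hn
        obtain ⟨hm0, hm⟩ := Finset.mem_erase.mp hm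
        obtain ⟨k, rfl⟩ := Nat.exists_eq_succ_of_ne_zero hm0
        exact h _ hm
    · rintro ⟨h0, h1⟩ n hn
      cases n with
      | zero => simpa [hn] using h0
      | succ n => exact h1 n (by
          rw [hs', Finset.mem_image]
          exact ⟨n + 1, Finset.mem_erase.mpr ⟨by simp, hn⟩, rfl⟩)
  have hprod : ∏ i ∈ s', expMeasure r (t (i + 1)) = ∏ i ∈ s.erase 0, expMeasure r (t i) := by
    rw [hs', Finset.prod_image]
    · refine Finset.prod_congr rfl fun i hi => ?_
      rw [Nat.succ_pred_eq_of_ne_zero (Finset.ne_of_mem_erase hi) |> fun h => (h : i.pred + 1 = i)]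
    · intro a ha b hb hab
      exact Nat.pred_inj (Nat.pos_of_ne_zero (Finset.ne_of_mem_erase ha))
        (Nat.pos_of_ne_zero (Finset.ne_of_mem_erase hb)) hab
  rw [Measure.map_apply measurable_seqCons (MeasurableSet.pi s.countable_toSet fun i _ => ht i),
    hpre, Measure.prod_prod, expSeq, Measure.infinitePi_pi _ (fun i _ => ht (i + 1)), hprod]
  split_ifs with h0
  · rw [Finset.mul_prod_erase s (fun i => expMeasure r (t i)) h0]
  · simp [Finset.erase_eq_of_notMem h0]

lemma lintegral_expSeq {r : ℝ} (hr : 0 < r) {F : (ℕ → ℝ) → ℝ≥0∞} (hF : Measurable F) :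
    ∫⁻ x, F x ∂(expSeq r) = ∫⁻ u, ∫⁻ x, F (seqCons u x) ∂(expSeq r) ∂(expMeasure r) := by
  have := isProbabilityMeasure_expMeasure hr
  have := isProbabilityMeasure_expSeq hr
  conv_lhs => rw [← map_seqCons hr]
  rw [lintegral_map hF measurable_seqCons, lintegral_prod _ (by
    exact (hF.comp measurable_seqCons).aemeasurable)]

end Sequences

/-! ### Renewal of the race at its first block. -/

section Renewal

variable {a b : ℝ}

/-- The law of the times between successive blocks of the honest miners and of the attacker. -/
noncomputable def raceLaw (a b : ℝ) : Measure ((ℕ → ℝ) × (ℕ → ℝ)) := (expSeq a).prod (expSeq b)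

lemma isProbabilityMeasure_raceLaw (ha : 0 < a) (hb : 0 < b) :
    IsProbabilityMeasure (raceLaw a b) := by
  have := isProbabilityMeasure_expSeq ha
  have := isProbabilityMeasure_expSeq hb
  unfold raceLaw
  infer_instance

/-- The times between successive blocks after the first block of the race, which is a block of the
honest miners. -/
def residualHonest (w : (ℕ → ℝ) × (ℕ → ℝ)) : (ℕ → ℝ) × (ℕ → ℝ) :=
  (seqTail w.1, seqCons (w.2 0 - w.1 0) (seqTail w.2))

lemma measurable_residualHonest : Measurable residualHonest := by
  have h1 : Measurable fun w : (ℕ → ℝ) × (ℕ → ℝ) => w.1 0 := (measurable_pi_apply 0).comp measurable_fst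
  have h2 : Measurable fun w : (ℕ → ℝ) × (ℕ → ℝ) => w.2 0 := (measurable_pi_apply 0).comp measurable_snd
  exact (measurable_seqTail.comp measurable_fst).prodMk
    (measurable_seqCons.comp ((h2.sub h1).prodMk (measurable_seqTail.comp measurable_snd)))

lemma measurableSet_honestFirst :
    MeasurableSet {w : (ℕ → ℝ) × (ℕ → ℝ) | w.1 0 < w.2 0} :=
  measurableSet_lt ((measurable_pi_apply 0).comp measurable_fst)
    ((measurable_pi_apply 0).comp measurable_snd)

/-- Condition on the first honest time `u`: the attacker's first time exceeds `u` with probability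
`exp (-(b * u))`, and its excess is again exponential. The weight changes the rate of `u` from `a`
to `a + b` and yields the factor `a / (a + b)`. -/
lemma lintegral_honestFirst (ha : 0 < a) (hb : 0 < b) {g : ℝ → ℝ≥0∞} (hg : Measurable g)
    {F : (ℕ → ℝ) × (ℕ → ℝ) → ℝ≥0∞} (hF : Measurable F) :
    ∫⁻ w, {w : (ℕ → ℝ) × (ℕ → ℝ) | w.1 0 < w.2 0}.indicator
        (fun w => g (w.1 0) * F (residualHonest w)) w ∂(raceLaw a b) =
      ENNReal.ofReal (a / (a + b)) * (∫⁻ u, g u ∂(expMeasure (a + b))) *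
        ∫⁻ w, F w ∂(raceLaw a b) := by
  have := isProbabilityMeasure_expMeasure ha
  have := isProbabilityMeasure_expMeasure hb
  have := isProbabilityMeasure_expSeq ha
  have := isProbabilityMeasure_expSeq hb
  set Φ : (ℕ → ℝ) × (ℕ → ℝ) → ℝ≥0∞ := {w : (ℕ → ℝ) × (ℕ → ℝ) | w.1 0 < w.2 0}.indicator
    (fun w => g (w.1 0) * F (residualHonest w)) with hΦ
  have hg' : Measurable fun w : (ℕ → ℝ) × (ℕ → ℝ) => g (w.1 0) :=
    hg.comp ((measurable_pi_apply 0).comp measurable_fst)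
  have hΦm : Measurable Φ :=
    (hg'.mul (hF.comp measurable_residualHonest)).indicator measurableSet_honestFirst
  have hval : ∀ u x w y, Φ (seqCons u x, seqCons w y) =
      (Set.Ioi u).indicator (fun w => g u * F (x, seqCons (w - u) y)) w := by
    intro u x w y
    by_cases h : u < w
    · rw [Set.indicator_of_mem (Set.mem_Ioi.mpr h), hΦ, Set.indicator_of_mem (by simpa using h)]
      rfl
    · rw [Set.indicator_of_notMem (by simpa using h), hΦ,
        Set.indicator_of_notMem (by simpa using h)]
  -- Only the attacker's first time is affected by `u`; memorylessness restores its law.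
  have hinner : ∀ u, 0 ≤ u → ∀ x, ∫⁻ y, Φ (seqCons u x, y) ∂(expSeq b) =
      g u * ENNReal.ofReal (Real.exp (-(b * u))) * ∫⁻ y, F (x, y) ∂(expSeq b) := by
    intro u hu x
    have hm : Measurable fun z : ℝ × (ℕ → ℝ) => F (x, seqCons z.1 z.2) :=
      hF.comp (measurable_const.prodMk measurable_seqCons)
    have hm1 : Measurable fun s => ∫⁻ y, F (x, seqCons s y) ∂(expSeq b) :=
      hm.lintegral_prod_right'
    rw [lintegral_expSeq hb (F := fun y => Φ (seqCons u x, y))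
      (hΦm.comp (measurable_const.prodMk measurable_id))]
    have h1 : ∀ w, ∫⁻ y, Φ (seqCons u x, seqCons w y) ∂(expSeq b) =
        g u * (Set.Ioi u).indicator (fun w => ∫⁻ y, F (x, seqCons (w - u) y) ∂(expSeq b)) w := by
      intro w
      simp_rw [hval]
      by_cases h : u < w
      · simp only [Set.indicator_of_mem (Set.mem_Ioi.mpr h)]
        rw [lintegral_const_mul]
        exact hm.comp (measurable_const.prodMk measurable_id)
      · simp only [Set.indicator_of_notMem (show w ∉ Set.Ioi u by simpa using h), mul_zero,
          lintegral_zero]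
    simp only [h1]
    have hm2 : Measurable fun w => ∫⁻ y, F (x, seqCons (w - u) y) ∂(expSeq b) :=
      hm1.comp (measurable_id.sub_const u)
    rw [lintegral_const_mul _ (hm2.indicator measurableSet_Ioi),
      lintegral_expMeasure_memoryless (h := fun s => ∫⁻ y, F (x, seqCons s y) ∂(expSeq b)) hm1 hu,
      ← lintegral_expSeq hb (F := fun y => F (x, y)) (hF.comp (measurable_const.prodMk measurable_id)),
      mul_assoc]
  rw [raceLaw, lintegral_prod _ hΦm.aemeasurable, lintegral_prod _ hF.aemeasurable,
    lintegral_expSeq ha hΦm.lintegral_prod_right']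
  have hae : ∀ᵐ u ∂(expMeasure a), 0 ≤ u := by
    have h0 : ∀ᵐ u ∂(expMeasure a), u ∉ Set.Iic (0 : ℝ) :=
      measure_eq_zero_iff_ae_notMem.mp (expMeasure_nonpos a)
    filter_upwards [h0] with u hu
    exact (not_le.mp hu).le
  calc ∫⁻ u, ∫⁻ x, ∫⁻ y, Φ (seqCons u x, y) ∂(expSeq b) ∂(expSeq a) ∂(expMeasure a)
      = ∫⁻ u, (g u * ENNReal.ofReal (Real.exp (-(b * u)))) *
          (∫⁻ x, ∫⁻ y, F (x, y) ∂(expSeq b) ∂(expSeq a)) ∂(expMeasure a) := by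
        refine lintegral_congr_ae ?_
        filter_upwards [hae] with u hu
        simp_rw [hinner u hu]
        rw [lintegral_const_mul _ hF.lintegral_prod_right']
    _ = _ := by
        rw [lintegral_mul_const _ (by fun_prop), lintegral_expMeasure_tilt ha hb hg]

/-- The race in which the honest miners and the attacker have changed places. -/
lemma map_swap_raceLaw (ha : 0 < a) (hb : 0 < b) :
    (raceLaw a b).map Prod.swap = raceLaw b a := by
  have := isProbabilityMeasure_expSeq ha
  have := isProbabilityMeasure_expSeq hb
  exact Measure.prod_swap

lemma ae_ne_raceLaw (ha : 0 < a) (hb : 0 < b) : ∀ᵐ w ∂(raceLaw a b), w.1 0 ≠ w.2 0 := by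
  have := isProbabilityMeasure_expSeq ha
  have := isProbabilityMeasure_expSeq hb
  have hm : MeasurableSet {w : (ℕ → ℝ) × (ℕ → ℝ) | w.1 0 ≠ w.2 0} :=
    (measurableSet_eq_fun ((measurable_pi_apply 0).comp measurable_fst)
      ((measurable_pi_apply 0).comp measurable_snd)).compl
  rw [raceLaw, Measure.ae_prod_iff_ae_ae hm]
  refine Filter.Eventually.of_forall fun x => ?_
  have := isProbabilityMeasure_expMeasure hb
  have h1 : (expSeq b).map (fun y => y 0) = expMeasure b :=
    Measure.infinitePi_map_eval (μ := fun _ => expMeasure b) 0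
  have h2 : ∀ᵐ t ∂(expMeasure b), x 0 ≠ t := by
    have : ∀ᵐ t ∂(expMeasure b), t ∉ ({x 0} : Set ℝ) :=
      measure_eq_zero_iff_ae_notMem.mp (expMeasure_singleton b (x 0))
    filter_upwards [this] with t ht h
    exact ht h.symm
  rw [← h1] at h2
  exact ae_of_ae_map (measurable_pi_apply 0).aemeasurable h2

open Classical in
/-- The times between successive blocks after the first block of the race. -/
noncomputable def residual (w : (ℕ → ℝ) × (ℕ → ℝ)) : (ℕ → ℝ) × (ℕ → ℝ) :=
  if w.1 0 < w.2 0 then residualHonest w else (residualHonest w.swap).swap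

open Classical in
/-- Whether the first block of the race is a block of the honest miners. -/
noncomputable def honestFirst (w : (ℕ → ℝ) × (ℕ → ℝ)) : Bool := decide (w.1 0 < w.2 0)

/-- The time of the first block of the race. -/
noncomputable def firstTime (w : (ℕ → ℝ) × (ℕ → ℝ)) : ℝ := min (w.1 0) (w.2 0)

lemma measurable_residual : Measurable residual :=
  Measurable.ite measurableSet_honestFirst measurable_residualHonest
    (measurable_swap.comp (measurable_residualHonest.comp measurable_swap))

lemma measurable_firstTime : Measurable firstTime :=
  ((measurable_pi_apply 0).comp measurable_fst).min ((measurable_pi_apply 0).comp measurable_snd)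

lemma measurable_of_honestFirst {β : Type*} [MeasurableSpace β]
    {f : Bool → (ℕ → ℝ) × (ℕ → ℝ) → β} (hf : ∀ e, Measurable (f e)) :
    Measurable fun w => f (honestFirst w) w := by
  classical
  have : (fun w => f (honestFirst w) w) = fun w => if w.1 0 < w.2 0 then f true w else f false w := by
    funext w
    by_cases h : w.1 0 < w.2 0 <;> simp [honestFirst, h]
  rw [this]
  exact Measurable.ite measurableSet_honestFirst (hf true) (hf false)

/-- The renewal property of the race: the time of the first block, its miner and the residual race
are independent, and the residual race has the law of the race. -/
theorem lintegral_renewal (ha : 0 < a) (hb : 0 < b) {g : ℝ → ℝ≥0∞} (hg : Measurable g)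
    {F : Bool → (ℕ → ℝ) × (ℕ → ℝ) → ℝ≥0∞} (hF : ∀ e, Measurable (F e)) :
    ∫⁻ w, g (firstTime w) * F (honestFirst w) (residual w) ∂(raceLaw a b) =
      (∫⁻ u, g u ∂(expMeasure (a + b))) *
        (ENNReal.ofReal (a / (a + b)) * ∫⁻ w, F true w ∂(raceLaw a b) +
          ENNReal.ofReal (b / (a + b)) * ∫⁻ w, F false w ∂(raceLaw a b)) := by
  have hA := lintegral_honestFirst ha hb hg (hF true)
  -- The case of an attacker's block is the honest case of the race with exchanged roles.
  have hB := lintegral_honestFirst hb ha hg ((hF false).comp measurable_swap)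
  set Φ : (ℕ → ℝ) × (ℕ → ℝ) → ℝ≥0∞ := {w : (ℕ → ℝ) × (ℕ → ℝ) | w.1 0 < w.2 0}.indicator
    (fun w => g (w.1 0) * (F false ∘ Prod.swap) (residualHonest w)) with hΦ
  have hg' : Measurable fun w : (ℕ → ℝ) × (ℕ → ℝ) => g (w.1 0) :=
    hg.comp ((measurable_pi_apply 0).comp measurable_fst)
  have hm1 : Measurable ({w : (ℕ → ℝ) × (ℕ → ℝ) | w.1 0 < w.2 0}.indicator
      (fun w => g (w.1 0) * F true (residualHonest w))) :=
    (hg'.mul ((hF true).comp measurable_residualHonest)).indicator measurableSet_honestFirst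
  have hΦm : Measurable Φ :=
    (hg'.mul (((hF false).comp measurable_swap).comp measurable_residualHonest)).indicator
      measurableSet_honestFirst
  have hFs : ∫⁻ w, (F false ∘ Prod.swap) w ∂(raceLaw b a) = ∫⁻ w, F false w ∂(raceLaw a b) := by
    rw [← map_swap_raceLaw hb ha, lintegral_map (hF false) measurable_swap]
    rfl
  rw [← map_swap_raceLaw ha hb, lintegral_map hΦm measurable_swap, map_swap_raceLaw ha hb, hFs] at hB
  -- Ties are null, so almost everywhere exactly one of the two indicators is active.
  have hsplit : ∫⁻ w, g (firstTime w) * F (honestFirst w) (residual w) ∂(raceLaw a b) =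
      ∫⁻ w, ({w : (ℕ → ℝ) × (ℕ → ℝ) | w.1 0 < w.2 0}.indicator
        (fun w => g (w.1 0) * F true (residualHonest w)) w + Φ w.swap) ∂(raceLaw a b) := by
    refine lintegral_congr_ae ?_
    filter_upwards [ae_ne_raceLaw ha hb] with w hw
    rcases lt_or_gt_of_ne hw with h | h
    · have h' : ¬ w.2 0 < w.1 0 := h.le.not_gt
      simp [hΦ, honestFirst, residual, firstTime, h, h', h.le]
    · have h' : ¬ w.1 0 < w.2 0 := h.le.not_gt
      simp [hΦ, honestFirst, residual, firstTime, h, h', h.le]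
  rw [hsplit, lintegral_add_left hm1, hA, hB, add_comm b a]
  ring

/-- Its use is to carry almost sure properties of the race over to the race after any number of
blocks. -/
lemma measurePreserving_residual (ha : 0 < a) (hb : 0 < b) :
    MeasurePreserving residual (raceLaw a b) (raceLaw a b) := by
  refine ⟨measurable_residual, Measure.ext fun s hs => ?_⟩
  have := isProbabilityMeasure_expMeasure (add_pos ha hb)
  have h := lintegral_renewal ha hb (g := fun _ => 1) measurable_const
    (F := fun _ => s.indicator 1) (fun _ => measurable_one.indicator hs)
  have h1 : (fun w => s.indicator (1 : (ℕ → ℝ) × (ℕ → ℝ) → ℝ≥0∞) (residual w)) =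
      (residual ⁻¹' s).indicator 1 := rfl
  simp only [one_mul, h1, lintegral_one, measure_univ] at h
  rw [lintegral_indicator_one (measurable_residual hs), lintegral_indicator_one hs, ← add_mul,
    ← ENNReal.ofReal_add (by positivity) (by positivity), ← add_div,
    div_self (by positivity), ENNReal.ofReal_one, one_mul] at h
  rw [Measure.map_apply measurable_residual hs, h]

end Renewal

/-! ### Games driven by the blocks: truncated payoffs and one-step equations. -/

section Chain

variable {S : Type*} (step : S → Bool → S) (stopped : S → Prop) [DecidablePred stopped]
  (c : ℝ) (r : S → ℝ)

/-- The payoff of a game that is driven by the miners of the successive blocks of the race and that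
is played for at most `n` blocks: the time is paid at the rate `c` until a state is reached in which
the game is stopped, and the reward `r` is paid in this state. -/
noncomputable def payoff : ℕ → S → (ℕ → ℝ) × (ℕ → ℝ) → ℝ≥0∞
  | 0, s, _ => if stopped s then ENNReal.ofReal (r s) else 0
  | n + 1, s, w => if stopped s then ENNReal.ofReal (r s) else
      ENNReal.ofReal c * ENNReal.ofReal (firstTime w) +
        payoff n (step s (honestFirst w)) (residual w)

/-- The expected payoff when the game is played for at most `n` blocks. -/
noncomputable def meanPayoff (p q τ : ℝ) : ℕ → S → ℝ
  | 0, s => if stopped s then r s else 0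
  | n + 1, s => if stopped s then r s else
      c * τ + (p * meanPayoff p q τ n (step s true) + q * meanPayoff p q τ n (step s false))

variable {step stopped c r}

lemma payoff_of_stopped {s : S} (h : stopped s) (n : ℕ) (w : (ℕ → ℝ) × (ℕ → ℝ)) :
    payoff step stopped c r n s w = ENNReal.ofReal (r s) := by
  cases n <;> simp [payoff, h]

lemma payoff_succ_of_not_stopped {s : S} (h : ¬ stopped s) (n : ℕ) (w : (ℕ → ℝ) × (ℕ → ℝ)) :
    payoff step stopped c r (n + 1) s w = ENNReal.ofReal c * ENNReal.ofReal (firstTime w) +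
        payoff step stopped c r n (step s (honestFirst w)) (residual w) := by
  simp [payoff, h]

lemma measurable_payoff (n : ℕ) (s : S) : Measurable (payoff step stopped c r n s) := by
  induction n generalizing s with
  | zero => simp only [payoff]; exact measurable_const
  | succ n ih =>
    by_cases h : stopped s
    · have : payoff step stopped c r (n + 1) s = fun _ => ENNReal.ofReal (r s) :=
        funext fun w => payoff_of_stopped h _ w
      rw [this]
      exact measurable_const
    · have : payoff step stopped c r (n + 1) s = fun w =>
          ENNReal.ofReal c * ENNReal.ofReal (firstTime w) +
            payoff step stopped c r n (step s (honestFirst w)) (residual w) :=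
        funext fun w => payoff_succ_of_not_stopped h _ w
      rw [this]
      refine (measurable_firstTime.ennreal_ofReal.const_mul _).add ?_
      exact measurable_of_honestFirst
        (f := fun e w => payoff step stopped c r n (step s e) (residual w))
        fun e => (ih (step s e)).comp measurable_residual

lemma monotone_payoff (s : S) (w : (ℕ → ℝ) × (ℕ → ℝ)) :
    Monotone fun n => payoff step stopped c r n s w := by
  refine monotone_nat_of_le_succ fun n => ?_
  induction n generalizing s w with
  | zero =>
    by_cases h : stopped s
    · simp only [payoff_of_stopped h, le_refl]
    · simp [payoff, h]
  | succ n ih =>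
    by_cases h : stopped s
    · simp only [payoff_of_stopped h, le_refl]
    · simp only [payoff_succ_of_not_stopped h]
      gcongr
      exact ih _ _

section Mean

variable {a b : ℝ}

lemma meanPayoff_nonneg (hc : 0 ≤ c) (hr : ∀ s, 0 ≤ r s) {p q τ : ℝ} (hp : 0 ≤ p) (hq : 0 ≤ q)
    (hτ : 0 ≤ τ) (n : ℕ) (s : S) : 0 ≤ meanPayoff step stopped c r p q τ n s := by
  induction n generalizing s with
  | zero => simp only [meanPayoff]; split_ifs; exacts [hr s, le_rfl]
  | succ n ih =>
    have h1 := ih (step s true)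
    have h2 := ih (step s false)
    simp only [meanPayoff]
    split_ifs
    exacts [hr s, by positivity]

lemma lintegral_payoff (ha : 0 < a) (hb : 0 < b) (hc : 0 ≤ c) (hr : ∀ s, 0 ≤ r s) (n : ℕ) (s : S) :
    ∫⁻ w, payoff step stopped c r n s w ∂(raceLaw a b) =
      ENNReal.ofReal
        (meanPayoff step stopped c r (a / (a + b)) (b / (a + b)) (1 / (a + b)) n s) := by
  have := isProbabilityMeasure_raceLaw ha hb
  have := isProbabilityMeasure_expMeasure (add_pos ha hb)
  induction n generalizing s with
  | zero => by_cases h : stopped s <;> simp [payoff, meanPayoff, h]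
  | succ n ih =>
    by_cases h : stopped s
    · simp [payoff_of_stopped h, meanPayoff, h]
    -- The payoff is a sum, so the elapsed time and the continuation are averaged separately, each
    -- with the other factor equal to 1.
    · have h1 := lintegral_renewal ha hb (g := ENNReal.ofReal) ENNReal.measurable_ofReal
        (F := fun _ _ => 1) fun _ => measurable_const
      have h2 := lintegral_renewal ha hb (g := fun _ => 1) measurable_const
        (F := fun e => payoff step stopped c r n (step s e)) fun e => measurable_payoff n _
      simp only [mul_one, one_mul, lintegral_one, measure_univ, ih,
        lintegral_id_expMeasure (add_pos ha hb)] at h1 h2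
      rw [← ENNReal.ofReal_add (by positivity) (by positivity), ← add_div,
        div_self (by positivity), ENNReal.ofReal_one, mul_one] at h1
      simp only [payoff_succ_of_not_stopped h]
      rw [lintegral_add_left (measurable_firstTime.ennreal_ofReal.const_mul _),
        lintegral_const_mul _ measurable_firstTime.ennreal_ofReal, h1, h2]
      have hn := meanPayoff_nonneg (step := step) (stopped := stopped) hc hr
        (p := a / (a + b)) (q := b / (a + b)) (τ := 1 / (a + b))
        (by positivity) (by positivity) (by positivity) n
      have hn1 := hn (step s true)
      have hn2 := hn (step s false)
      simp only [meanPayoff, if_neg h]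
      rw [← ENNReal.ofReal_mul hc, ← ENNReal.ofReal_mul (by positivity),
        ← ENNReal.ofReal_mul (by positivity), ← ENNReal.ofReal_add (by positivity) (by positivity),
        ← ENNReal.ofReal_add (by positivity) (by positivity)]

variable {V W : S → ℝ} {C ρ p q τ : ℝ}

/-- The error vanishes in stopped states and elsewhere is the average of the errors one step later.
The supersolution `W` bounds it, and each averaging gains a factor `ρ`. -/
lemma abs_sub_meanPayoff_le (hp : 0 ≤ p) (hq : 0 ≤ q)
    (hrew : ∀ s, stopped s → V s = r s)
    (hstep : ∀ s, ¬ stopped s → V s = c * τ + (p * V (step s true) + q * V (step s false)))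
    (hW : ∀ s, 0 ≤ W s)
    (hWstep : ∀ s, ¬ stopped s → p * W (step s true) + q * W (step s false) ≤ ρ * W s)
    (hC : 0 ≤ C) (hρ : 0 ≤ ρ) (hVW : ∀ s, ¬ stopped s → |V s| ≤ C * W s) (n : ℕ) (s : S) :
    |V s - meanPayoff step stopped c r p q τ n s| ≤ C * ρ ^ n * W s := by
  induction n generalizing s with
  | zero =>
    by_cases h : stopped s
    · simp only [meanPayoff, if_pos h, hrew s h, sub_self, abs_zero]
      have := hW s
      positivity
    · simpa [meanPayoff, h] using hVW s h
  | succ n ih =>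
    by_cases h : stopped s
    · simp only [meanPayoff, if_pos h, hrew s h, sub_self, abs_zero]
      have := hW s
      positivity
    · simp only [meanPayoff, if_neg h]
      rw [hstep s h]
      have e : c * τ + (p * V (step s true) + q * V (step s false)) -
          (c * τ + (p * meanPayoff step stopped c r p q τ n (step s true) +
            q * meanPayoff step stopped c r p q τ n (step s false))) =
          p * (V (step s true) - meanPayoff step stopped c r p q τ n (step s true)) +
          q * (V (step s false) - meanPayoff step stopped c r p q τ n (step s false)) := by ring
      rw [e]
      calc _ ≤ p * |V (step s true) - meanPayoff step stopped c r p q τ n (step s true)| +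
          q * |V (step s false) - meanPayoff step stopped c r p q τ n (step s false)| := by
            refine (abs_add_le _ _).trans ?_
            rw [abs_mul, abs_mul, abs_of_nonneg hp, abs_of_nonneg hq]
        _ ≤ p * (C * ρ ^ n * W (step s true)) + q * (C * ρ ^ n * W (step s false)) := by
            gcongr
            exacts [ih _, ih _]
        _ = C * ρ ^ n * (p * W (step s true) + q * W (step s false)) := by ring
        _ ≤ C * ρ ^ n * (ρ * W s) := by
            gcongr
            exact hWstep s h
        _ = C * ρ ^ (n + 1) * W s := by ring

lemma tendsto_meanPayoff (hp : 0 ≤ p) (hq : 0 ≤ q)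
    (hrew : ∀ s, stopped s → V s = r s)
    (hstep : ∀ s, ¬ stopped s → V s = c * τ + (p * V (step s true) + q * V (step s false)))
    (hW : ∀ s, 0 ≤ W s)
    (hWstep : ∀ s, ¬ stopped s → p * W (step s true) + q * W (step s false) ≤ ρ * W s)
    (hC : 0 ≤ C) (hρ : 0 ≤ ρ) (hρ1 : ρ < 1) (hVW : ∀ s, ¬ stopped s → |V s| ≤ C * W s) (s : S) :
    Filter.Tendsto (fun n => meanPayoff step stopped c r p q τ n s) Filter.atTop (nhds (V s)) := by
  have h0 : Filter.Tendsto (fun n : ℕ => C * ρ ^ n * W s) Filter.atTop (nhds 0) := by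
    simpa using ((tendsto_pow_atTop_nhds_zero_of_lt_one hρ hρ1).const_mul C).mul_const (W s)
  rw [tendsto_iff_dist_tendsto_zero]
  refine squeeze_zero (fun n => dist_nonneg) (fun n => ?_) h0
  rw [dist_comm, Real.dist_eq]
  exact abs_sub_meanPayoff_le hp hq hrew hstep hW hWstep hC hρ hVW n s

/-- The expected payoff of the game is the solution of the one-step equations, if this solution is
dominated by a function that decreases geometrically in the mean. -/
theorem lintegral_iSup_payoff (ha : 0 < a) (hb : 0 < b) (hc : 0 ≤ c) (hr : ∀ s, 0 ≤ r s)
    (hrew : ∀ s, stopped s → V s = r s)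
    (hstep : ∀ s, ¬ stopped s → V s = c * (1 / (a + b)) +
      (a / (a + b) * V (step s true) + b / (a + b) * V (step s false)))
    (hW : ∀ s, 0 ≤ W s)
    (hWstep : ∀ s, ¬ stopped s →
      a / (a + b) * W (step s true) + b / (a + b) * W (step s false) ≤ ρ * W s)
    (hC : 0 ≤ C) (hρ : 0 ≤ ρ) (hρ1 : ρ < 1) (hVW : ∀ s, ¬ stopped s → |V s| ≤ C * W s) (s : S) :
    0 ≤ V s ∧ ∫⁻ w, ⨆ n, payoff step stopped c r n s w ∂(raceLaw a b) = ENNReal.ofReal (V s) := by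
  have ht := tendsto_meanPayoff (r := r) (c := c) (τ := 1 / (a + b))
    (div_nonneg ha.le (add_pos ha hb).le) (div_nonneg hb.le (add_pos ha hb).le)
    hrew hstep hW hWstep hC hρ hρ1 hVW s
  refine ⟨ge_of_tendsto' ht fun n => meanPayoff_nonneg hc hr (div_nonneg ha.le (add_pos ha hb).le)
    (div_nonneg hb.le (add_pos ha hb).le) (by positivity) n s, ?_⟩
  rw [lintegral_iSup (fun n => measurable_payoff n s) fun i j hij w => monotone_payoff s w hij]
  simp only [lintegral_payoff ha hb hc hr]
  refine iSup_eq_of_tendsto (fun i j hij => ?_) (ENNReal.tendsto_ofReal ht)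
  simp only [← lintegral_payoff ha hb hc hr]
  exact lintegral_mono fun w => monotone_payoff s w hij

end Mean

end Chain

/-! ### Block counts before and after the first block. -/

section Counting

/-- The number of blocks discovered up to time `t`, given the times `x` between them. -/
noncomputable def seqCount (x : ℕ → ℝ) (t : ℝ) : ℕ :=
  {n : ℕ | ∑ i ∈ Finset.range (n + 1), x i ≤ t}.ncard

variable {x : ℕ → ℝ} {t : ℝ}

lemma seqCount_eq_zero (hx : ∀ i, 0 < x i) (ht : t < x 0) : seqCount x t = 0 := by
  have : {n : ℕ | ∑ i ∈ Finset.range (n + 1), x i ≤ t} = ∅ := by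
    refine Set.eq_empty_of_forall_notMem fun n hn => ?_
    have h1 : x 0 ≤ ∑ i ∈ Finset.range (n + 1), x i :=
      Finset.single_le_sum (fun i _ => (hx i).le) (by simp)
    exact absurd (h1.trans hn) (not_le.mpr ht)
  rw [seqCount, this, Set.ncard_empty]

/-- Finiteness matters: `ncard` is `0` on infinite sets, where adding the first block would not be
counted. -/
lemma seqCount_seqTail (hfin : {n : ℕ | ∑ i ∈ Finset.range (n + 1), x i ≤ t}.Finite)
    (ht : x 0 ≤ t) : seqCount x t = 1 + seqCount (seqTail x) (t - x 0) := by
  have h : {n : ℕ | ∑ i ∈ Finset.range (n + 1), x i ≤ t} =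
      insert 0 (Nat.succ '' {n : ℕ | ∑ i ∈ Finset.range (n + 1), seqTail x i ≤ t - x 0}) := by
    ext n
    cases n with
    | zero => simpa using ht
    | succ n =>
      simp only [Set.mem_ofPred_eq, Set.mem_insert_iff, Nat.succ_eq_add_one, Set.mem_image,
        Nat.add_right_cancel_iff, exists_eq_right, Nat.add_eq_zero_iff, one_ne_zero, and_false,
        false_or]
      rw [Finset.sum_range_succ' x (n + 1), ← le_sub_iff_add_le]
      rfl
  have hfin' : (Nat.succ '' {n : ℕ | ∑ i ∈ Finset.range (n + 1), seqTail x i ≤ t - x 0}).Finite :=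
    hfin.subset (by rw [h]; exact Set.subset_insert _ _)
  rw [seqCount, h, Set.ncard_insert_of_notMem (by simp) hfin',
    Set.ncard_image_of_injective _ Nat.succ_injective, add_comm]
  rfl

/-- Every partial sum involved contains the first term, so lowering that term by `u` is the same as
moving the clock by `u`. -/
lemma seqCount_seqCons_sub (x : ℕ → ℝ) (t u : ℝ) :
    seqCount (seqCons (x 0 - u) (seqTail x)) (t - u) = seqCount x t := by
  unfold seqCount
  congr 1
  ext n
  simp only [Set.mem_ofPred_eq]
  rw [Finset.sum_range_succ', Finset.sum_range_succ' x]
  simp only [seqCons_succ, seqCons_zero, seqTail]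
  constructor <;> intro h <;> linarith

end Counting

/-! ### States of a cycle and their continuous-time counterparts. -/

/-- The times between successive blocks are positive, the first two blocks of the two sides are not
simultaneous, and finitely many blocks are discovered in a bounded time. -/
structure IsRegular (w : (ℕ → ℝ) × (ℕ → ℝ)) : Prop where
  pos_fst : ∀ i, 0 < w.1 i
  pos_snd : ∀ i, 0 < w.2 i
  ne : w.1 0 ≠ w.2 0
  finite_fst : ∀ t, {n : ℕ | ∑ i ∈ Finset.range (n + 1), w.1 i ≤ t}.Finite
  finite_snd : ∀ t, {n : ℕ | ∑ i ∈ Finset.range (n + 1), w.2 i ≤ t}.Finite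

/-- The state of an attack cycle: `none` during the pre-mining, and afterwards the number of
confirmations and the length of the secret fork. A block is mined by the honest miners (`true`) or
by the attacker (`false`). -/
def cycleStep : Option (ℕ × ℕ) → Bool → Option (ℕ × ℕ)
  | none, true => none
  | none, false => some (0, 1)
  | some (h, f), true => some (h + 1, f)
  | some (h, f), false => some (h, f + 1)

/-- The states in which an attack cycle ends. -/
def CycleEnds (A z : ℕ) : Option (ℕ × ℕ) → Prop
  | none => False
  | some (h, f) => A + f ≤ h ∨ (z ≤ h ∧ h < f)

noncomputable instance (A z : ℕ) : DecidablePred (CycleEnds A z) := fun _ => Classical.dec _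

/-- The confirmations at time `t` of a cycle that is in the state `s` at time `0`. -/
noncomputable def raceConf (s : Option (ℕ × ℕ)) (w : (ℕ → ℝ) × (ℕ → ℝ)) (t : ℝ) : ℤ :=
  match s with
  | none => (seqCount w.1 t : ℤ) - seqCount w.1 (w.2 0)
  | some (h, _) => h + seqCount w.1 t

/-- The secret fork at time `t` of a cycle that is in the state `s` at time `0`. -/
noncomputable def raceFork (s : Option (ℕ × ℕ)) (w : (ℕ → ℝ) × (ℕ → ℝ)) (t : ℝ) : ℤ :=
  match s with
  | none => 1 + ((seqCount w.2 t : ℤ) - seqCount w.2 (w.2 0))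
  | some (_, f) => f + seqCount w.2 t

/-- The launch time of a cycle that is in the state `s` at time `0`. -/
noncomputable def raceStart (s : Option (ℕ × ℕ)) (w : (ℕ → ℝ) × (ℕ → ℝ)) : ℝ :=
  match s with
  | none => w.2 0
  | some _ => 0

/-- The times that end a cycle that is in the state `s` at time `0`. -/
def raceEnd (A z : ℕ) (s : Option (ℕ × ℕ)) (w : (ℕ → ℝ) × (ℕ → ℝ)) : Set ℝ :=
  {t | raceStart s w ≤ t ∧ ((A : ℤ) ≤ raceConf s w t - raceFork s w t ∨
    ((z : ℤ) ≤ raceConf s w t ∧ raceConf s w t - raceFork s w t < 0))}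

/-- The duration of a cycle that is in the state `s` at time `0`. -/
noncomputable def raceDuration (A z : ℕ) (s : Option (ℕ × ℕ)) (w : (ℕ → ℝ) × (ℕ → ℝ)) : ℝ :=
  sInf (raceEnd A z s w)

/-! ### Pathwise link between the continuous-time cycle and the chain. -/

section Shift

variable {w : (ℕ → ℝ) × (ℕ → ℝ)} {t : ℝ}

lemma residual_of_lt (h : w.1 0 < w.2 0) :
    residual w = (seqTail w.1, seqCons (w.2 0 - w.1 0) (seqTail w.2)) := by
  simp [residual, h, residualHonest]

lemma residual_of_gt (h : w.2 0 < w.1 0) :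
    residual w = (seqCons (w.1 0 - w.2 0) (seqTail w.1), seqTail w.2) := by
  simp [residual, h.le.not_gt, residualHonest]

lemma honestFirst_of_lt (h : w.1 0 < w.2 0) : honestFirst w = true := by simp [honestFirst, h]

lemma honestFirst_of_gt (h : w.2 0 < w.1 0) : honestFirst w = false := by
  simp [honestFirst, h.le]

lemma firstTime_of_lt (h : w.1 0 < w.2 0) : firstTime w = w.1 0 := min_eq_left h.le

lemma firstTime_of_gt (h : w.2 0 < w.1 0) : firstTime w = w.2 0 := min_eq_right h.le

lemma IsRegular.firstTime_pos (hw : IsRegular w) : 0 < firstTime w :=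
  lt_min (hw.pos_fst 0) (hw.pos_snd 0)

/-- A first honest block raises `h` by 1 after the launch; during the pre-mining it enters both
counts and cancels. An attacker's first block does not alter the honest counts, and the subtracted
count is `0` if it is the launching block. -/
lemma raceConf_residual (hw : IsRegular w) (s : Option (ℕ × ℕ)) (ht : firstTime w ≤ t) :
    raceConf (cycleStep s (honestFirst w)) (residual w) (t - firstTime w) = raceConf s w t := by
  rcases lt_or_gt_of_ne hw.ne with h | h
  · rw [firstTime_of_lt h] at ht ⊢
    have h1 := seqCount_seqTail (hw.finite_fst t) ht
    have h2 := seqCount_seqTail (hw.finite_fst (w.2 0)) h.le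
    rw [honestFirst_of_lt h, residual_of_lt h]
    rcases s with _ | ⟨k, f⟩
    · simp [cycleStep, raceConf, h1, h2]
    · simp [cycleStep, raceConf, h1]
      ring
  · rw [firstTime_of_gt h] at ht ⊢
    rw [honestFirst_of_gt h, residual_of_gt h]
    have h1 := seqCount_seqCons_sub w.1 t (w.2 0)
    rcases s with _ | ⟨k, f⟩
    · simp [cycleStep, raceConf, h1, seqCount_eq_zero hw.pos_fst h]
    · simp [cycleStep, raceConf, h1]

lemma raceFork_residual (hw : IsRegular w) (s : Option (ℕ × ℕ)) (ht : firstTime w ≤ t) :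
    raceFork (cycleStep s (honestFirst w)) (residual w) (t - firstTime w) = raceFork s w t := by
  rcases lt_or_gt_of_ne hw.ne with h | h
  · rw [firstTime_of_lt h] at ht ⊢
    rw [honestFirst_of_lt h, residual_of_lt h]
    have h1 := seqCount_seqCons_sub w.2 t (w.1 0)
    have h2 := seqCount_seqCons_sub w.2 (w.2 0) (w.1 0)
    rcases s with _ | ⟨k, f⟩
    · simp [cycleStep, raceFork, h1, h2]
    · simp [cycleStep, raceFork, h1]
  · rw [firstTime_of_gt h] at ht ⊢
    rw [honestFirst_of_gt h, residual_of_gt h]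
    have h1 := seqCount_seqTail (hw.finite_snd t) ht
    have h2 := seqCount_seqTail (hw.finite_snd (w.2 0)) le_rfl
    -- At the launch the attacker's count is exactly 1: the pre-mined block is included and no
    -- other.
    have h3 : seqCount (seqTail w.2) (w.2 0 - w.2 0) = 0 :=
      seqCount_eq_zero (fun i => hw.pos_snd (i + 1)) (by rw [sub_self]; exact hw.pos_snd 1)
    rcases s with _ | ⟨k, f⟩
    · simp only [cycleStep, raceFork, h1, h2, h3]
      push_cast
      ring
    · simp [cycleStep, raceFork, h1]
      ring

lemma raceStart_residual (hw : IsRegular w) (s : Option (ℕ × ℕ)) (ht : firstTime w ≤ t) :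
    raceStart (cycleStep s (honestFirst w)) (residual w) ≤ t - firstTime w ↔
      raceStart s w ≤ t := by
  have h0 := hw.firstTime_pos
  rcases lt_or_gt_of_ne hw.ne with h | h
  · rw [firstTime_of_lt h] at ht h0 ⊢
    rw [honestFirst_of_lt h, residual_of_lt h]
    rcases s with _ | ⟨k, f⟩
    · simp [cycleStep, raceStart]
    · simp [cycleStep, raceStart, ht, h0.le.trans ht]
  · rw [firstTime_of_gt h] at ht h0 ⊢
    rw [honestFirst_of_gt h, residual_of_gt h]
    rcases s with _ | ⟨k, f⟩
    · simp [cycleStep, raceStart]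
    · simp [cycleStep, raceStart, ht, h0.le.trans ht]

lemma raceStart_nonneg (hw : IsRegular w) (s : Option (ℕ × ℕ)) : 0 ≤ raceStart s w := by
  rcases s with _ | s
  · exact (hw.pos_snd 0).le
  · exact le_rfl

variable {A z : ℕ} {s : Option (ℕ × ℕ)}

lemma bddBelow_raceEnd (hw : IsRegular w) : BddBelow (raceEnd A z s w) :=
  ⟨0, fun _ ht => (raceStart_nonneg hw s).trans ht.1⟩

lemma raceDuration_nonneg (hw : IsRegular w) : 0 ≤ raceDuration A z s w :=
  Real.sInf_nonneg fun _ ht => (raceStart_nonneg hw s).trans ht.1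

lemma raceConf_of_lt (hw : IsRegular w) {h f : ℕ} (ht : t < firstTime w) :
    raceConf (some (h, f)) w t = h := by
  simp [raceConf, seqCount_eq_zero hw.pos_fst (ht.trans_le (min_le_left _ _))]

lemma raceFork_of_lt (hw : IsRegular w) {h f : ℕ} (ht : t < firstTime w) :
    raceFork (some (h, f)) w t = f := by
  simp [raceFork, seqCount_eq_zero hw.pos_snd (ht.trans_le (min_le_right _ _))]

lemma raceEnd_eq_image (hw : IsRegular w) (hw' : IsRegular (residual w)) (hs : ¬ CycleEnds A z s) :
    raceEnd A z s w = (fun t => firstTime w + t) ''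
      raceEnd A z (cycleStep s (honestFirst w)) (residual w) := by
  have key : ∀ t, firstTime w ≤ t → (t ∈ raceEnd A z s w ↔
      t - firstTime w ∈ raceEnd A z (cycleStep s (honestFirst w)) (residual w)) := by
    intro t ht
    simp only [raceEnd, Set.mem_ofPred_eq, raceConf_residual hw s ht, raceFork_residual hw s ht,
      raceStart_residual hw s ht]
  -- No count changes before the first block, and the pre-mining cannot end earlier either.
  have hlow : ∀ t ∈ raceEnd A z s w, firstTime w ≤ t := by
    intro t ht
    by_contra hlt
    rw [not_le] at hlt
    rcases s with _ | ⟨h, f⟩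
    · exact absurd (ht.1.trans_lt hlt) (not_lt.mpr (min_le_right _ _))
    · have h1 := ht.2
      rw [raceConf_of_lt hw hlt, raceFork_of_lt hw hlt] at h1
      exact hs (by simp only [CycleEnds]; omega)
  ext t
  constructor
  · intro ht
    exact ⟨t - firstTime w, (key t (hlow t ht)).mp ht, by simp⟩
  · rintro ⟨u, hu, rfl⟩
    have hu0 : 0 ≤ u := (raceStart_nonneg hw' _).trans hu.1
    exact (key _ (by linarith)).mpr (by simpa using hu)

/-- Nonemptiness is essential: `sInf ∅ = 0` would break the shift by the first time. -/
lemma raceDuration_of_not_ends (hw : IsRegular w) (hw' : IsRegular (residual w))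
    (hs : ¬ CycleEnds A z s)
    (hne : (raceEnd A z (cycleStep s (honestFirst w)) (residual w)).Nonempty) :
    raceDuration A z s w = firstTime w +
      raceDuration A z (cycleStep s (honestFirst w)) (residual w) := by
  rw [raceDuration, raceEnd_eq_image hw hw' hs]
  exact ((OrderIso.addLeft (firstTime w)).map_csInf' hne (bddBelow_raceEnd hw')).symm

lemma zero_mem_raceEnd (hw : IsRegular w) (hs : CycleEnds A z s) : (0 : ℝ) ∈ raceEnd A z s w := by
  rcases s with _ | ⟨h, f⟩
  · exact hs.elim
  · refine ⟨le_rfl, ?_⟩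
    rw [raceConf_of_lt hw hw.firstTime_pos, raceFork_of_lt hw hw.firstTime_pos]
    simp only [CycleEnds] at hs
    omega

lemma raceDuration_of_ends (hw : IsRegular w) (hs : CycleEnds A z s) : raceDuration A z s w = 0 :=
  le_antisymm (csInf_le (bddBelow_raceEnd hw) (zero_mem_raceEnd hw hs)) (raceDuration_nonneg hw)

/-- The cycle that is in the state `s` at time `0` ends with one of the next `n` blocks. -/
def EndsWithin (A z : ℕ) : ℕ → Option (ℕ × ℕ) → (ℕ → ℝ) × (ℕ → ℝ) → Prop
  | 0, s, _ => CycleEnds A z s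
  | n + 1, s, w => CycleEnds A z s ∨ EndsWithin A z n (cycleStep s (honestFirst w)) (residual w)

/-- With no charge for time, a positive payoff can only come from an ending state; this detects
cycles that never end. -/
lemma payoff_eq_zero_of_not_endsWithin {n : ℕ} {r : Option (ℕ × ℕ) → ℝ}
    (h : ¬ EndsWithin A z n s w) : payoff cycleStep (CycleEnds A z) 0 r n s w = 0 := by
  induction n generalizing s w with
  | zero =>
    have h' : ¬ CycleEnds A z s := h
    simp [payoff, h']
  | succ n ih =>
    have h' : ¬ CycleEnds A z s := fun hs => h (Or.inl hs)
    rw [payoff_succ_of_not_stopped h', ih fun hn => h (Or.inr hn)]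
    simp

/-- A reward that depends on the confirmations and on the secret fork at the end of a cycle. -/
def endReward (ρ : ℤ → ℤ → ℝ) : Option (ℕ × ℕ) → ℝ
  | none => 0
  | some (h, f) => ρ h f

lemma endsWithin_spec_of_ends {ρ : ℤ → ℤ → ℝ} {c : ℝ} (hw : IsRegular w) (hs : CycleEnds A z s)
    (n : ℕ) : (raceEnd A z s w).Nonempty ∧ ∀ k, n ≤ k →
      payoff cycleStep (CycleEnds A z) c (endReward ρ) k s w =
        ENNReal.ofReal c * ENNReal.ofReal (raceDuration A z s w) +
        ENNReal.ofReal (ρ (raceConf s w (raceDuration A z s w))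
          (raceFork s w (raceDuration A z s w))) := by
  refine ⟨⟨0, zero_mem_raceEnd hw hs⟩, fun k _ => ?_⟩
  rw [payoff_of_stopped hs, raceDuration_of_ends hw hs]
  rcases s with _ | ⟨h, f⟩
  · exact hs.elim
  · rw [raceConf_of_lt hw hw.firstTime_pos, raceFork_of_lt hw hw.firstTime_pos]
    simp [endReward]

/-- Induction on the number of blocks, peeling off the first one. Once the cycle has ended, the
truncated payoff no longer depends on the truncation and equals the charge for the actual duration
plus the actual reward. -/
lemma endsWithin_spec {ρ : ℤ → ℤ → ℝ} {c : ℝ} {n : ℕ} (hw : ∀ k, IsRegular (residual^[k] w))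
    (h : EndsWithin A z n s w) : (raceEnd A z s w).Nonempty ∧ ∀ k, n ≤ k →
      payoff cycleStep (CycleEnds A z) c (endReward ρ) k s w =
        ENNReal.ofReal c * ENNReal.ofReal (raceDuration A z s w) +
        ENNReal.ofReal (ρ (raceConf s w (raceDuration A z s w))
          (raceFork s w (raceDuration A z s w))) := by
  induction n generalizing s w with
  | zero => exact endsWithin_spec_of_ends (hw 0) h 0
  | succ n ih =>
    have hw0 : IsRegular w := hw 0
    have hw1 : IsRegular (residual w) := hw 1
    by_cases hs : CycleEnds A z s
    · exact endsWithin_spec_of_ends hw0 hs _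
    · obtain ⟨hne, hk⟩ := ih (w := residual w) (fun k => hw (k + 1)) (h.resolve_left hs)
      have hD := raceDuration_of_not_ends hw0 hw1 hs hne
      have h0 := raceDuration_nonneg (A := A) (z := z) (s := cycleStep s (honestFirst w)) hw1
      refine ⟨?_, fun k hnk => ?_⟩
      · rw [raceEnd_eq_image hw0 hw1 hs]
        exact hne.image _
      · obtain ⟨k, rfl⟩ : ∃ j, k = j + 1 := ⟨k - 1, by omega⟩
        have hle : firstTime w ≤ raceDuration A z s w := by linarith
        rw [payoff_succ_of_not_stopped hs, hk k (by omega), ← raceConf_residual hw0 s hle,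
          ← raceFork_residual hw0 s hle, hD, add_sub_cancel_left,
          ENNReal.ofReal_add hw0.firstTime_pos.le h0]
        ring

end Shift

/-! ### Almost sure regularity of the race. -/

section Regular

variable {a b r : ℝ}

lemma ae_expSeq_pos (hr : 0 < r) : ∀ᵐ x ∂(expSeq r), ∀ i, 0 < x i := by
  have := isProbabilityMeasure_expMeasure hr
  refine ae_all_iff.mpr fun i => ?_
  have h1 : (expSeq r).map (fun x => x i) = expMeasure r :=
    Measure.infinitePi_map_eval (μ := fun _ => expMeasure r) i
  have h2 : ∀ᵐ t ∂(expMeasure r), 0 < t := by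
    have : ∀ᵐ t ∂(expMeasure r), t ∉ Set.Iic (0 : ℝ) :=
      measure_eq_zero_iff_ae_notMem.mp (expMeasure_nonpos r)
    filter_upwards [this] with t ht
    exact not_le.mp ht
  rw [← h1] at h2
  exact ae_of_ae_map (measurable_pi_apply i).aemeasurable h2

lemma integrable_id_expMeasure (hr : 0 < r) : Integrable id (expMeasure r) := by
  refine ⟨aestronglyMeasurable_id, ?_⟩
  rw [hasFiniteIntegral_iff_norm]
  have h : ∀ᵐ t ∂(expMeasure r), t ∉ Set.Iic (0 : ℝ) :=
    measure_eq_zero_iff_ae_notMem.mp (expMeasure_nonpos r)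
  have : ∫⁻ t, ENNReal.ofReal ‖id t‖ ∂(expMeasure r) = ∫⁻ t, ENNReal.ofReal t ∂(expMeasure r) := by
    refine lintegral_congr_ae ?_
    filter_upwards [h] with t ht
    rw [id, Real.norm_of_nonneg (not_le.mp ht).le]
  rw [this, lintegral_id_expMeasure hr]
  exact ENNReal.ofReal_lt_top

lemma integral_id_expMeasure (hr : 0 < r) : ∫ t, t ∂(expMeasure r) = 1 / r := by
  have h : ∀ᵐ t ∂(expMeasure r), t ∉ Set.Iic (0 : ℝ) :=
    measure_eq_zero_iff_ae_notMem.mp (expMeasure_nonpos r)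
  rw [integral_eq_lintegral_of_nonneg_ae (by filter_upwards [h] with t ht; exact (not_le.mp ht).le)
    measurable_id'.aestronglyMeasurable, lintegral_id_expMeasure hr, ENNReal.toReal_ofReal (by positivity)]

/-- By the strong law of large numbers the partial sums grow like `n / r`, so only finitely many
stay below a given time. -/
lemma ae_expSeq_finite (hr : 0 < r) :
    ∀ᵐ x ∂(expSeq r), ∀ t : ℝ, {n : ℕ | ∑ i ∈ Finset.range (n + 1), x i ≤ t}.Finite := by
  have := isProbabilityMeasure_expMeasure hr
  have := isProbabilityMeasure_expSeq hr
  have hmap : ∀ i, (expSeq r).map (fun x => x i) = expMeasure r := fun i =>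
    Measure.infinitePi_map_eval (μ := fun _ => expMeasure r) i
  have hm : ∀ i, Measurable fun x : ℕ → ℝ => x i := measurable_pi_apply
  have hind : iIndepFun (fun i (x : ℕ → ℝ) => x i) (expSeq r) :=
    iIndepFun_infinitePi (P := fun _ : ℕ => expMeasure r) (X := fun _ t => t)
      fun _ => measurable_id
  have hint : Integrable (fun x : ℕ → ℝ => x 0) (expSeq r) := by
    have h := integrable_id_expMeasure hr
    rw [← hmap 0] at h
    exact h.comp_measurable (hm 0)
  have hmean : ∫ x, x 0 ∂(expSeq r) = 1 / r := by
    rw [← integral_id_expMeasure hr, ← hmap 0, integral_map (hm 0).aemeasurable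
      measurable_id'.aestronglyMeasurable]
  have hslln := strong_law_ae_real (μ := expSeq r) (fun i x => x i) hint
    (fun i j hij => hind.indepFun hij)
    fun i => ⟨(hm i).aemeasurable, (hm 0).aemeasurable, by rw [hmap i, hmap 0]⟩
  rw [hmean] at hslln
  filter_upwards [hslln] with x hx t
  have htop : Filter.Tendsto (fun n : ℕ => ∑ i ∈ Finset.range n, x i) Filter.atTop Filter.atTop := by
    have h1 := hx.pos_mul_atTop (by positivity) tendsto_natCast_atTop_atTop
    refine h1.congr' ?_
    filter_upwards [Filter.eventually_gt_atTop 0] with n hn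
    have : (n : ℝ) ≠ 0 := by exact_mod_cast hn.ne'
    field_simp
  have h2 := ((Filter.tendsto_add_atTop_iff_nat 1).mpr htop).eventually_gt_atTop t
  rw [← Nat.cofinite_eq_atTop, Filter.eventually_cofinite] at h2
  simpa only [not_lt] using h2

lemma ae_isRegular (ha : 0 < a) (hb : 0 < b) : ∀ᵐ w ∂(raceLaw a b), IsRegular w := by
  have := isProbabilityMeasure_expSeq ha
  have := isProbabilityMeasure_expSeq hb
  have h1 := (Measure.quasiMeasurePreserving_fst (μ := expSeq a) (ν := expSeq b)).ae
    ((ae_expSeq_pos ha).and (ae_expSeq_finite ha))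
  have h2 := (Measure.quasiMeasurePreserving_snd (μ := expSeq a) (ν := expSeq b)).ae
    ((ae_expSeq_pos hb).and (ae_expSeq_finite hb))
  filter_upwards [h1, h2, ae_ne_raceLaw ha hb] with w h1 h2 h3
  exact ⟨h1.1, h2.1, h3, h1.2, h2.2⟩

lemma ae_isRegular_iterate (ha : 0 < a) (hb : 0 < b) :
    ∀ᵐ w ∂(raceLaw a b), ∀ k, IsRegular (residual^[k] w) :=
  ae_all_iff.mpr fun k =>
    ((measurePreserving_residual ha hb).iterate k).quasiMeasurePreserving.ae (ae_isRegular ha hb)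

end Regular

/-! ### Transfer from the mining model to the canonical race. -/

section Law

variable {Ω : Type*} [MeasurableSpace Ω] {μ : Measure Ω}

lemma map_sumElim_raceLaw {a b : ℝ} (ha : 0 < a) (hb : 0 < b) :
    (raceLaw a b).map (fun w => (Sum.elim w.1 w.2 : ℕ ⊕ ℕ → ℝ)) =
      Measure.infinitePi (Sum.elim (fun _ => expMeasure a) fun _ => expMeasure b) := by
  have := isProbabilityMeasure_expMeasure ha
  have := isProbabilityMeasure_expMeasure hb
  have := isProbabilityMeasure_expSeq ha
  have := isProbabilityMeasure_expSeq hb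
  have : ∀ i : ℕ ⊕ ℕ, IsProbabilityMeasure
      ((Sum.elim (fun _ => expMeasure a) fun _ => expMeasure b : ℕ ⊕ ℕ → Measure ℝ) i) := by
    rintro (i | i) <;> simpa
  have hm : Measurable fun w : (ℕ → ℝ) × (ℕ → ℝ) => (Sum.elim w.1 w.2 : ℕ ⊕ ℕ → ℝ) := by
    refine measurable_pi_iff.mpr ?_
    rintro (i | i)
    · exact (measurable_pi_apply i).comp measurable_fst
    · exact (measurable_pi_apply i).comp measurable_snd
  refine Measure.eq_infinitePi _ fun s t ht => ?_
  have hpre : (fun w : (ℕ → ℝ) × (ℕ → ℝ) => (Sum.elim w.1 w.2 : ℕ ⊕ ℕ → ℝ)) ⁻¹' (Set.pi s t) =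
      (Set.pi s.toLeft fun i => t (Sum.inl i)) ×ˢ (Set.pi s.toRight fun i => t (Sum.inr i)) := by
    ext w
    simp [Set.mem_pi]
  rw [Measure.map_apply hm (MeasurableSet.pi s.countable_toSet fun i _ => ht i), hpre, raceLaw,
    Measure.prod_prod, expSeq, expSeq, Measure.infinitePi_pi _ (fun i _ => ht _),
    Measure.infinitePi_pi _ (fun i _ => ht _)]
  conv_rhs => rw [← Finset.toLeft_disjSum_toRight (u := s), Finset.prod_disjSum]
  rfl

lemma IsMiningRace.aemeasurable {p q τ₀ : ℝ} {X Y : ℕ → Ω → ℝ}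
    (h : IsMiningRace μ p q τ₀ X Y) :
    AEMeasurable (fun ω => ((fun i => X i ω, fun i => Y i ω) : (ℕ → ℝ) × (ℕ → ℝ))) μ :=
  (aemeasurable_pi_iff.mpr fun i => (h.honest_law i).aemeasurable).prodMk
    (aemeasurable_pi_iff.mpr fun i => (h.attacker_law i).aemeasurable)

/-- Joint independence over `ℕ ⊕ ℕ` makes the law of the whole family a product measure, which
`map_sumElim_raceLaw` also finds for the canonical race. -/
lemma IsMiningRace.map_eq {p q τ₀ : ℝ} {X Y : ℕ → Ω → ℝ} (h : IsMiningRace μ p q τ₀ X Y)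
    (ha : 0 < p / τ₀) (hb : 0 < q / τ₀) :
    μ.map (fun ω => ((fun i => X i ω, fun i => Y i ω) : (ℕ → ℝ) × (ℕ → ℝ))) =
      raceLaw (p / τ₀) (q / τ₀) := by
  have := isProbabilityMeasure_expMeasure ha
  have := isProbabilityMeasure_expMeasure hb
  have : ∀ i : ℕ ⊕ ℕ, IsProbabilityMeasure
      ((Sum.elim (fun _ => expMeasure (p / τ₀)) fun _ => expMeasure (q / τ₀) :
        ℕ ⊕ ℕ → Measure ℝ) i) := by
    rintro (i | i) <;> simpa
  have hlaw : ∀ i : ℕ ⊕ ℕ, HasLaw (Sum.elim X Y i)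
      ((Sum.elim (fun _ => expMeasure (p / τ₀)) fun _ => expMeasure (q / τ₀) :
        ℕ ⊕ ℕ → Measure ℝ) i) μ := by
    rintro (i | i)
    exacts [h.honest_law i, h.attacker_law i]
  have hae : AEMeasurable (fun ω i => Sum.elim X Y i ω) μ :=
    aemeasurable_pi_iff.mpr fun i => (hlaw i).aemeasurable
  have h1 := (h.indep.hasLaw_infinitePi hlaw hae).map_eq
  have hm : Measurable fun g : ℕ ⊕ ℕ → ℝ =>
      ((fun i => g (Sum.inl i), fun i => g (Sum.inr i)) : (ℕ → ℝ) × (ℕ → ℝ)) :=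
    (measurable_pi_iff.mpr fun i => measurable_pi_apply _).prodMk
      (measurable_pi_iff.mpr fun i => measurable_pi_apply _)
  have hm' : Measurable fun w : (ℕ → ℝ) × (ℕ → ℝ) => (Sum.elim w.1 w.2 : ℕ ⊕ ℕ → ℝ) := by
    refine measurable_pi_iff.mpr ?_
    rintro (i | i)
    · exact (measurable_pi_apply i).comp measurable_fst
    · exact (measurable_pi_apply i).comp measurable_snd
  have h2 := congrArg (Measure.map fun g : ℕ ⊕ ℕ → ℝ =>
      ((fun i => g (Sum.inl i), fun i => g (Sum.inr i)) : (ℕ → ℝ) × (ℕ → ℝ))) h1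
  rw [← map_sumElim_raceLaw ha hb, AEMeasurable.map_map_of_aemeasurable hm.aemeasurable hae,
    Measure.map_map hm hm'] at h2
  exact h2.trans Measure.map_id

end Law

/-! ### A Lyapunov function for the chain. -/

section Lyapunov

variable {p q : ℝ}

/-- A function of the state that decreases geometrically in the mean and that dominates the length
of the secret fork as long as the attacker does not give up. -/
lemma exists_lyapunov (hq0 : 0 < q) (hq : q < 1 / 2) (hp : p = 1 - q) (A : ℕ) :
    ∃ (W : Option (ℕ × ℕ) → ℝ) (ρ C : ℝ), 0 ≤ ρ ∧ ρ < 1 ∧ 0 ≤ C ∧ (∀ s, 0 ≤ W s) ∧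
      (∀ s, p * W (cycleStep s true) + q * W (cycleStep s false) ≤ ρ * W s) ∧
      1 ≤ C * W none ∧ ∀ h f : ℕ, h ≤ A + f → 1 + (f : ℝ) ≤ C * W (some (h, f)) := by
  have hp0 : 1 / 2 < p := by linarith
  have hpq : p * q < 1 / 4 := by rw [hp]; nlinarith [sq_pos_of_pos (sub_pos.mpr hq)]
  -- The choice gives `p α = 1/2` and `q β = p q + 1/4`. Since `p q < 1/4`, it achieves `p α + q β <
  -- 1` and `α β > 1` together: `α^h β^f` decreases in the mean, yet grows exponentially in `f`
  -- while `h ≤ A + f`.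
  set α : ℝ := 1 / (2 * p) with hα
  set β : ℝ := p + 1 / (4 * q) with hβ
  have hα0 : 0 < α := by positivity
  have hβ0 : 0 < β := by positivity
  have hα1 : α ≤ 1 := by rw [hα, div_le_one (by positivity)]; linarith
  have hpα : p * α = 1 / 2 := by rw [hα]; field_simp
  have hqβ : q * β = p * q + 1 / 4 := by rw [hβ]; field_simp
  have hγ : 1 < α * β := by
    have h1 : p * q * (α * β) = 1 / 2 * (p * q + 1 / 4) := by
      rw [← hqβ, ← hpα]; ring
    by_contra hle
    rw [not_lt] at hle
    have : p * q * (α * β) ≤ p * q := mul_le_of_le_one_right (by positivity) hle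
    linarith
  set ρ : ℝ := max (p * α + q * β) ((1 + p) / 2) with hρ
  -- Bernoulli's inequality gives `δ (1 + f) ≤ (α β)^f`.
  set δ : ℝ := min 1 (α * β - 1) with hδ
  have hδ0 : 0 < δ := lt_min one_pos (by linarith)
  -- With the value `2 β` for the pre-mining, its one-step mean is `2 p β + q β = (1 + p) β`, which
  -- is why `(1 + p) / 2` enters `ρ`.
  refine ⟨fun s => s.elim (2 * β) fun x => α ^ x.1 * β ^ x.2, ρ,
    max (1 / (2 * β)) (1 / (δ * α ^ A)), ?_, ?_, ?_, ?_, ?_, ?_, ?_⟩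
  · exact (by positivity : 0 ≤ (1 + p) / 2).trans (le_max_right _ _)
  · refine max_lt ?_ ?_
    · rw [hpα, hqβ]; linarith
    · linarith
  · exact (by positivity : 0 ≤ 1 / (2 * β)).trans (le_max_left _ _)
  · rintro (_ | ⟨h, f⟩)
    · simp only [Option.elim_none]; positivity
    · simp only [Option.elim_some]; positivity
  · rintro (_ | ⟨h, f⟩)
    · simp only [cycleStep, Option.elim_none, Option.elim_some, pow_zero, one_mul, pow_one]
      have : (1 + p) / 2 * (2 * β) ≤ ρ * (2 * β) := by gcongr; exact le_max_right _ _
      refine le_trans (le_of_eq ?_) this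
      rw [hp]; ring
    · simp only [cycleStep, Option.elim_some]
      have : (p * α + q * β) * (α ^ h * β ^ f) ≤ ρ * (α ^ h * β ^ f) := by
        gcongr; exact le_max_left _ _
      refine le_trans (le_of_eq ?_) this
      ring
  · have : 1 / (2 * β) * (2 * β) ≤ max (1 / (2 * β)) (1 / (δ * α ^ A)) * (2 * β) := by
      gcongr; exact le_max_left _ _
    rwa [one_div_mul_cancel (by positivity)] at this
  · intro h f hf
    simp only [Option.elim_some]
    have h1 : 1 + (f : ℝ) * (α * β - 1) ≤ (α * β) ^ f := by
      have := one_add_mul_le_pow (a := α * β - 1) (by linarith) f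
      rwa [add_sub_cancel] at this
    have h2 : δ * (1 + f) ≤ 1 + (f : ℝ) * (α * β - 1) := by
      have h3 : δ ≤ 1 := min_le_left _ _
      have h4 : (f : ℝ) * δ ≤ f * (α * β - 1) := by gcongr; exact min_le_right _ _
      linarith
    have h3 : α ^ (A + f) ≤ α ^ h := pow_le_pow_of_le_one hα0.le hα1 hf
    calc 1 + (f : ℝ) = 1 / (δ * α ^ A) * (α ^ A * (δ * (1 + f))) := by field_simp
      _ ≤ 1 / (δ * α ^ A) * (α ^ A * (α * β) ^ f) := by
        gcongr; exact h2.trans h1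
      _ = 1 / (δ * α ^ A) * (α ^ (A + f) * β ^ f) := by rw [mul_pow, pow_add]; ring
      _ ≤ 1 / (δ * α ^ A) * (α ^ h * β ^ f) := by gcongr
      _ ≤ _ := by gcongr; exact le_max_right _ _

end Lyapunov

/-! ### Expectations over an attack cycle from one-step equations. -/

section Cycle

variable {p q τ₀ : ℝ} {A z : ℕ}

/-- The expected payoff of an attack cycle is given by the solution of the one-step equations that
grows at most linearly with the length of the secret fork. -/
theorem lintegral_iSup_cycle (hq0 : 0 < q) (hq : q < 1 / 2) (hp : p = 1 - q) (hτ₀ : 0 < τ₀)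
    {c : ℝ} (hc : 0 ≤ c) {r V : Option (ℕ × ℕ) → ℝ} (hr : ∀ s, 0 ≤ r s)
    (hrew : ∀ s, CycleEnds A z s → V s = r s)
    (hstep : ∀ s, ¬ CycleEnds A z s →
      V s = c * τ₀ + (p * V (cycleStep s true) + q * V (cycleStep s false)))
    {C : ℝ} (hV : ∀ h f, ¬ CycleEnds A z (some (h, f)) → |V (some (h, f))| ≤ C * (1 + f)) :
    0 ≤ V none ∧
      ∫⁻ w, ⨆ n, payoff cycleStep (CycleEnds A z) c r n none w ∂(raceLaw (p / τ₀) (q / τ₀)) =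
        ENNReal.ofReal (V none) := by
  obtain ⟨W, ρ, C', hρ0, hρ1, hC', hW, hWstep, hWn, hWs⟩ := exists_lyapunov hq0 hq hp A
  have hp0 : 0 < p := by linarith
  have hsum : p / τ₀ + q / τ₀ = 1 / τ₀ := by rw [← add_div, hp]; ring
  have e1 : p / τ₀ / (p / τ₀ + q / τ₀) = p := by rw [hsum]; field_simp
  have e2 : q / τ₀ / (p / τ₀ + q / τ₀) = q := by rw [hsum]; field_simp
  have e3 : 1 / (p / τ₀ + q / τ₀) = τ₀ := by rw [hsum]; field_simp
  -- The growth hypothesis says nothing about the pre-mining state, so its value is absorbed into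
  -- the constant.
  set M : ℝ := max |C| |V none| with hM
  have hM0 : 0 ≤ M := (abs_nonneg _).trans (le_max_left _ _)
  refine lintegral_iSup_payoff (W := W) (ρ := ρ) (C := M * C') (by positivity) (by positivity) hc hr
    hrew (by rwa [e1, e2, e3]) hW (fun s _ => by rw [e1, e2]; exact hWstep s) (by positivity)
    hρ0 hρ1 ?_ none
  rintro (_ | ⟨h, f⟩) hs
  · calc |V none| ≤ M * 1 := by rw [mul_one]; exact le_max_right _ _
      _ ≤ M * (C' * W none) := by gcongr
      _ = M * C' * W none := by ring
  · have hf : h ≤ A + f := by simp only [CycleEnds] at hs; omega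
    calc |V (some (h, f))| ≤ C * (1 + f) := hV h f hs
      _ ≤ M * (1 + f) := by
        gcongr
        exact (le_abs_self C).trans (le_max_left _ _)
      _ ≤ M * (C' * W (some (h, f))) := by gcongr; exact hWs h f hf
      _ = M * C' * W (some (h, f)) := by ring

lemma payoff_le_one {r : Option (ℕ × ℕ) → ℝ} (hr : ∀ s, r s ≤ 1) (n : ℕ) (s : Option (ℕ × ℕ))
    (w : (ℕ → ℝ) × (ℕ → ℝ)) : payoff cycleStep (CycleEnds A z) 0 r n s w ≤ 1 := by
  induction n generalizing s w with
  | zero =>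
    simp only [payoff]
    split_ifs
    exacts [ENNReal.ofReal_le_one.mpr (hr s), zero_le_one]
  | succ n ih =>
    by_cases h : CycleEnds A z s
    · rw [payoff_of_stopped h]; exact ENNReal.ofReal_le_one.mpr (hr s)
    · rw [payoff_succ_of_not_stopped h]; simpa using ih _ _

/-- The constant 1 solves the equations with reward 1 and no charge, so the limiting payoff has mean
1. As it never exceeds 1, it is 1 almost surely, whereas it would be 0 on a cycle that never ends.
-/
lemma ae_endsWithin (hq0 : 0 < q) (hq : q < 1 / 2) (hp : p = 1 - q) (hτ₀ : 0 < τ₀) :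
    ∀ᵐ w ∂(raceLaw (p / τ₀) (q / τ₀)), ∃ n, EndsWithin A z n none w := by
  have hp0 : 0 < p := by linarith
  have := isProbabilityMeasure_raceLaw (a := p / τ₀) (b := q / τ₀) (by positivity) (by positivity)
  obtain ⟨-, h⟩ := lintegral_iSup_cycle (r := fun _ => 1) (V := fun _ => 1) (c := 0) (C := 1)
    hq0 hq hp hτ₀ le_rfl
    (fun _ => zero_le_one) (fun _ _ => rfl) (fun _ _ => by rw [hp]; ring)
    (fun _ f _ => by rw [abs_one, one_mul]; linarith [f.cast_nonneg (α := ℝ)])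
  have hle : ∀ w, ⨆ n, payoff cycleStep (CycleEnds A z) 0 (fun _ => 1) n none w ≤ 1 :=
    fun w => iSup_le fun n => payoff_le_one (fun _ => le_rfl) n none w
  have hae : ∀ᵐ w ∂(raceLaw (p / τ₀) (q / τ₀)),
      ⨆ n, payoff cycleStep (CycleEnds A z) 0 (fun _ => 1) n none w = 1 := by
    refine ae_eq_of_ae_le_of_lintegral_le (Filter.Eventually.of_forall hle) ?_
      aemeasurable_const ?_
    · rw [h]; exact ENNReal.ofReal_ne_top
    · rw [h]; simp
  filter_upwards [hae] with w hw
  by_contra hno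
  push Not at hno
  have : ⨆ n, payoff cycleStep (CycleEnds A z) 0 (fun _ => 1) n none w = 0 := by
    simp [payoff_eq_zero_of_not_endsWithin (hno _)]
  rw [this] at hw
  exact zero_ne_one hw

variable {Ω : Type*} {X Y : ℕ → Ω → ℝ}

lemma endingTimes_eq_raceEnd (ω : Ω) :
    endingTimes A z X Y ω = raceEnd A z none (fun i => X i ω, fun i => Y i ω) := by
  have h : launchTime Y ω = Y 0 ω := by simp [launchTime, discoveryTime]
  ext t
  simp only [endingTimes, raceEnd, GivesUpAt, SucceedsAt, lag, confirmations, secretFork, h]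
  rfl

lemma cycleDuration_eq_raceDuration (ω : Ω) :
    cycleDuration A z X Y ω = raceDuration A z none (fun i => X i ω, fun i => Y i ω) := by
  rw [cycleDuration, endingTimes_eq_raceEnd, raceDuration]

lemma confirmations_eq_raceConf (t : ℝ) (ω : Ω) :
    confirmations X Y t ω = raceConf none (fun i => X i ω, fun i => Y i ω) t := by
  have h : launchTime Y ω = Y 0 ω := by simp [launchTime, discoveryTime]
  rw [confirmations, h]
  rfl

lemma secretFork_eq_raceFork (t : ℝ) (ω : Ω) :
    secretFork Y t ω = raceFork none (fun i => X i ω, fun i => Y i ω) t := by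
  have h : launchTime Y ω = Y 0 ω := by simp [launchTime, discoveryTime]
  rw [secretFork, h]
  rfl

variable [MeasurableSpace Ω] {μ : Measure Ω}

theorem ae_nonempty_endingTimes (hq0 : 0 < q) (hq : q < 1 / 2) (hp : p = 1 - q) (hτ₀ : 0 < τ₀)
    (hrace : IsMiningRace μ p q τ₀ X Y) :
    ∀ᵐ ω ∂μ, (endingTimes A z X Y ω).Nonempty := by
  have hp0 : 0 < p := by linarith
  have ha : 0 < p / τ₀ := by positivity
  have hb : 0 < q / τ₀ := by positivity
  have h := (ae_isRegular_iterate ha hb).and (ae_endsWithin (A := A) (z := z) hq0 hq hp hτ₀)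
  rw [← hrace.map_eq ha hb] at h
  filter_upwards [ae_of_ae_map hrace.aemeasurable h] with ω hω
  obtain ⟨n, hn⟩ := hω.2
  rw [endingTimes_eq_raceEnd]
  exact (endsWithin_spec (ρ := fun _ _ => 0) (c := 0) hω.1 hn).1

/-- The expectation of a linear combination of the duration of an attack cycle and of a reward that
is paid at its end. -/
theorem integral_cycle (hq0 : 0 < q) (hq : q < 1 / 2) (hp : p = 1 - q) (hτ₀ : 0 < τ₀)
    (hrace : IsMiningRace μ p q τ₀ X Y)
    {c : ℝ} (hc : 0 ≤ c) {ρ : ℤ → ℤ → ℝ} (hρ : ∀ h f, 0 ≤ ρ h f) {V : Option (ℕ × ℕ) → ℝ}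
    (hrew : ∀ h f : ℕ, CycleEnds A z (some (h, f)) → V (some (h, f)) = ρ h f)
    (hstep : ∀ s, ¬ CycleEnds A z s →
      V s = c * τ₀ + (p * V (cycleStep s true) + q * V (cycleStep s false)))
    {C : ℝ} (hV : ∀ h f, ¬ CycleEnds A z (some (h, f)) → |V (some (h, f))| ≤ C * (1 + f)) :
    Integrable (fun ω => c * cycleDuration A z X Y ω +
        ρ (confirmations X Y (cycleDuration A z X Y ω) ω)
          (secretFork Y (cycleDuration A z X Y ω) ω)) μ ∧
      ∫ ω, (c * cycleDuration A z X Y ω +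
        ρ (confirmations X Y (cycleDuration A z X Y ω) ω)
          (secretFork Y (cycleDuration A z X Y ω) ω)) ∂μ = V none := by
  have hp0 : 0 < p := by linarith
  have ha : 0 < p / τ₀ := by positivity
  have hb : 0 < q / τ₀ := by positivity
  have hr : ∀ s, 0 ≤ endReward ρ s := by
    rintro (_ | ⟨h, f⟩)
    exacts [le_rfl, hρ _ _]
  obtain ⟨hV0, hint⟩ := lintegral_iSup_cycle (r := endReward ρ) (V := V) hq0 hq hp hτ₀ hc hr
    (by rintro (_ | ⟨h, f⟩) hs; exacts [hs.elim, hrew h f hs]) hstep hV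
  set Φ : (ℕ → ℝ) × (ℕ → ℝ) → ℝ≥0∞ :=
    fun w => ⨆ n, payoff cycleStep (CycleEnds A z) c (endReward ρ) n none w with hΦ
  have hΦm : Measurable Φ := Measurable.iSup fun n => measurable_payoff n none
  set T : Ω → (ℕ → ℝ) × (ℕ → ℝ) := fun ω => (fun i => X i ω, fun i => Y i ω) with hT
  have hTm : AEMeasurable T μ := hrace.aemeasurable
  have hmap : μ.map T = raceLaw (p / τ₀) (q / τ₀) := hrace.map_eq ha hb
  have hΦT : ∫⁻ ω, Φ (T ω) ∂μ = ENNReal.ofReal (V none) := by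
    rw [← hint, ← hmap, lintegral_map' hΦm.aemeasurable hTm]
  have hae : ∀ᵐ ω ∂μ, c * cycleDuration A z X Y ω +
        ρ (confirmations X Y (cycleDuration A z X Y ω) ω)
          (secretFork Y (cycleDuration A z X Y ω) ω) = (Φ (T ω)).toReal := by
    have h := (ae_isRegular_iterate ha hb).and (ae_endsWithin (A := A) (z := z) hq0 hq hp hτ₀)
    rw [← hmap] at h
    filter_upwards [ae_of_ae_map hTm h] with ω hω
    obtain ⟨n, hn⟩ := hω.2
    have hk := (endsWithin_spec (ρ := ρ) (c := c) hω.1 hn).2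
    -- The truncated payoffs increase up to `n` and are constant from then on.
    have hsup : Φ (T ω) = payoff cycleStep (CycleEnds A z) c (endReward ρ) n none (T ω) := by
      refine le_antisymm (iSup_le fun k => ?_) (le_iSup (fun k => payoff cycleStep (CycleEnds A z) c
        (endReward ρ) k none (T ω)) n)
      rcases le_total k n with hkn | hkn
      · exact monotone_payoff none (T ω) hkn
      · rw [hk k hkn, hk n le_rfl]
    have hD : 0 ≤ raceDuration A z none (T ω) := raceDuration_nonneg (hω.1 0)
    rw [hsup, hk n le_rfl, ← ENNReal.ofReal_mul hc, ← ENNReal.ofReal_add (mul_nonneg hc hD) (hρ _ _),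
      ENNReal.toReal_ofReal (add_nonneg (mul_nonneg hc hD) (hρ _ _)), cycleDuration_eq_raceDuration,
      confirmations_eq_raceConf, secretFork_eq_raceFork (X := X)]
  have hΦi : Integrable (fun ω => (Φ (T ω)).toReal) μ :=
    integrable_toReal_of_lintegral_ne_top (hΦm.comp_aemeasurable hTm)
      (by rw [hΦT]; exact ENNReal.ofReal_ne_top)
  refine ⟨hΦi.congr (hae.mono fun ω h => h.symm), ?_⟩
  rw [integral_congr_ae hae, integral_toReal (f := fun ω => Φ (T ω)) (hΦm.comp_aemeasurable hTm)
    (ae_lt_top' (hΦm.comp_aemeasurable hTm) (by rw [hΦT]; exact ENNReal.ofReal_ne_top)), hΦT,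
    ENNReal.toReal_ofReal hV0]

end Cycle

/-! ### An explicit solution of the one-step equations. -/

section Value

/-- The expectation of `χ (f + K)` restricted to `f + K ≤ z`, where `K` is the number of blocks that
the attacker mines before the `n`-th block of the honest miners. -/
noncomputable def confirmMean (p q : ℝ) (z : ℕ) (χ : ℕ → ℝ) (n f : ℕ) : ℝ :=
  ∑ k ∈ Finset.range (z + 1 - f), (n.multichoose k : ℝ) * p ^ n * q ^ k * χ (f + k)

variable {p q : ℝ} {z A : ℕ} {χ : ℕ → ℝ}

lemma confirmMean_of_lt {n f : ℕ} (hf : z < f) : confirmMean p q z χ n f = 0 := by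
  rw [confirmMean, Nat.sub_eq_zero_of_le (by omega)]
  simp

lemma confirmMean_zero {f : ℕ} (hf : f ≤ z) : confirmMean p q z χ 0 f = χ f := by
  rw [confirmMean, show z + 1 - f = (z - f) + 1 by omega, Finset.sum_range_succ']
  simp

/-- First-step analysis: the next block is honest (`n` awaited ones remain) or the attacker's (`f`
grows). Pascal's rule for `multichoose` matches the coefficients. -/
lemma confirmMean_succ (n f : ℕ) :
    confirmMean p q z χ (n + 1) f =
      p * confirmMean p q z χ n f + q * confirmMean p q z χ (n + 1) (f + 1) := by
  rcases lt_or_ge z f with hf | hf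
  · rw [confirmMean_of_lt hf, confirmMean_of_lt hf, confirmMean_of_lt (hf.trans (by omega))]
    simp
  · have h1 : z + 1 - f = (z - f) + 1 := by omega
    have h2 : z + 1 - (f + 1) = z - f := by omega
    simp only [confirmMean]
    rw [h1, h2, Finset.sum_range_succ', Finset.sum_range_succ' _ (z - f), mul_add, Finset.mul_sum,
      Finset.mul_sum, add_right_comm, ← Finset.sum_add_distrib]
    congr 1
    · refine Finset.sum_congr rfl fun k _ => ?_
      rw [Nat.multichoose_succ_succ, show f + 1 + k = f + (k + 1) by omega]
      push_cast
      ring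
    · simp
      ring

open Classical in
/-- The value of the states of an attack cycle: `L` is the value before the last confirmation if the
attack is sure to succeed then, `f * w d + u d` is the value when the secret fork of length `f` lacks
`d` blocks for a success, and `φ f` is the reward of a success. -/
noncomputable def cycleValue (p q e : ℝ) (A z : ℕ) (L : ℕ → ℕ → ℝ) (w u : ℕ → ℝ) (φ : ℤ → ℝ) :
    Option (ℕ × ℕ) → ℝ
  | none => e / q + (L 0 1 +
      confirmMean p q z (fun f => f * w (z + 1 - f) + u (z + 1 - f) - L z f) z 1)
  | some (h, f) =>
    if h < z then L h f +
      confirmMean p q z (fun f => f * w (z + 1 - f) + u (z + 1 - f) - L z f) (z - h) f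
    else if f ≤ h ∧ h ≤ A + f then f * w (h + 1 - f) + u (h + 1 - f)
    else if h < f then φ f else 0

variable {e : ℝ} {L : ℕ → ℕ → ℝ} {w u : ℕ → ℝ} {φ : ℤ → ℝ}

/-- The formula for states before the last confirmation remains valid at `h = z`, so the step that
brings the last confirmation needs no separate treatment. -/
lemma cycleValue_of_le (hA : z ≤ A) (hLz : ∀ f : ℕ, z < f → L z f = φ f) {h : ℕ} (hh : h ≤ z)
    (f : ℕ) : cycleValue p q e A z L w u φ (some (h, f)) = L h f +
      confirmMean p q z (fun f => f * w (z + 1 - f) + u (z + 1 - f) - L z f) (z - h) f := by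
  rcases hh.lt_or_eq with hlt | rfl
  · simp [cycleValue, hlt]
  · simp only [cycleValue, lt_irrefl, if_false, Nat.sub_self]
    rcases le_or_gt f h with hf | hf
    · rw [if_pos ⟨hf, by omega⟩, confirmMean_zero hf]
      ring
    · rw [if_neg (by omega), if_pos hf, confirmMean_of_lt hf, hLz f hf, add_zero]

/-- The equations for `w` and `u` come from comparing coefficients of `f`: an attacker's block turns
`f * w (d + 1)` into `(f + 1) * w d`, whence the extra source `q * w d` for `u`. During the
pre-mining, `1 / q` blocks are expected, whence `e / q`. -/
lemma cycleValue_step (hq0 : 0 < q) (hp : p = 1 - q) (hA : z ≤ A)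
    (hL : ∀ h f, h < z → L h f = e + (p * L (h + 1) f + q * L h (f + 1)))
    (hLz : ∀ f : ℕ, z < f → L z f = φ f)
    (hw : ∀ d < A, w (d + 1) = p * w (d + 2) + q * w d)
    (hu : ∀ d < A, u (d + 1) = e + (p * u (d + 2) + q * (u d + w d)))
    (h0 : ∀ f : ℕ, f * w 0 + u 0 = φ f) {s : Option (ℕ × ℕ)} (hs : ¬ CycleEnds A z s) :
    cycleValue p q e A z L w u φ s = e +
      (p * cycleValue p q e A z L w u φ (cycleStep s true) +
        q * cycleValue p q e A z L w u φ (cycleStep s false)) := by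
  rcases s with _ | ⟨h, f⟩
  · have h1 := cycleValue_of_le (p := p) (q := q) (e := e) (w := w) (u := u) hA hLz z.zero_le 1
    simp only [cycleStep]
    rw [h1]
    simp only [cycleValue, Nat.sub_zero]
    rw [hp]
    field_simp
    ring
  · simp only [cycleStep]
    rcases lt_or_ge h z with hh | hh
    · rw [cycleValue_of_le hA hLz hh.le, cycleValue_of_le hA hLz hh.le,
        cycleValue_of_le hA hLz (Nat.succ_le_of_lt hh), hL h f hh,
        show z - h = (z - (h + 1)) + 1 by omega, confirmMean_succ]
      ring
    · simp only [CycleEnds, not_or, not_and, not_le, not_lt] at hs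
      have hfh : f ≤ h := hs.2 hh
      obtain ⟨d, hd⟩ : ∃ d, h = f + d := ⟨h - f, by omega⟩
      subst hd
      have hdA : d < A := by omega
      have e1 : cycleValue p q e A z L w u φ (some (f + d, f)) = f * w (d + 1) + u (d + 1) := by
        simp only [cycleValue]
        rw [if_neg (by omega), if_pos (by omega), show f + d + 1 - f = d + 1 by omega]
      have e2 : cycleValue p q e A z L w u φ (some (f + d + 1, f)) =
          f * w (d + 2) + u (d + 2) := by
        simp only [cycleValue]
        rw [if_neg (by omega), if_pos (by omega), show f + d + 1 + 1 - f = d + 2 by omega]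
      have e3 : cycleValue p q e A z L w u φ (some (f + d, f + 1)) = (f + 1) * w d + u d := by
        simp only [cycleValue]
        rw [if_neg (by omega)]
        -- For `d = 0` the attacker's block brings success, and `h0` expresses its reward in the
        -- same form.
        rcases Nat.eq_zero_or_pos d with rfl | hd0
        · rw [if_neg (by omega), if_pos (by omega), ← h0 (f + 1)]
          push_cast
          ring
        · rw [if_pos (by omega), show f + d + 1 - (f + 1) = d by omega]
          push_cast
          ring
      rw [e1, e2, e3, hw d hdA, hu d hdA]
      ring

lemma cycleValue_of_ends (hA : z ≤ A) (hw : w (A + 1) = 0) (hu : u (A + 1) = 0)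
    {h f : ℕ} (hs : CycleEnds A z (some (h, f))) :
    cycleValue p q e A z L w u φ (some (h, f)) =
      if (z : ℤ) ≤ h ∧ (h : ℤ) - f < 0 then φ f else 0 := by
  simp only [CycleEnds] at hs
  simp only [cycleValue]
  rw [if_neg (by omega)]
  rcases lt_or_ge h f with hf | hf
  · rw [if_neg (by omega), if_pos hf, if_pos (by omega)]
  · rw [if_neg (show ¬ ((z : ℤ) ≤ h ∧ (h : ℤ) - f < 0) by omega)]
    split_ifs with h1
    · rw [show h + 1 - f = A + 1 by omega, hw, hu]
      simp
    · omega
    · rfl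

/-- `confirmMean` vanishes for `f > z`, and only lacks up to `A + 1` occur in unfinished states. So
finitely many values bound everything except `L` and the explicit factor `f`. -/
lemma exists_bound_cycleValue {D : ℝ} (hD : 0 ≤ D) (hLD : ∀ h f : ℕ, h < z → |L h f| ≤ D * (1 + f)) :
    ∃ C, ∀ h f, ¬ CycleEnds A z (some (h, f)) →
      |cycleValue p q e A z L w u φ (some (h, f))| ≤ C * (1 + f) := by
  set χ : ℕ → ℝ := fun f => f * w (z + 1 - f) + u (z + 1 - f) - L z f with hχ
  set M₁ : ℝ := ∑ n ∈ Finset.range (z + 1), ∑ f ∈ Finset.range (z + 1), |confirmMean p q z χ n f|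
    with hM₁
  set M₂ : ℝ := ∑ d ∈ Finset.range (A + 2), (|w d| + |u d|) with hM₂
  have hM₁0 : 0 ≤ M₁ := Finset.sum_nonneg fun _ _ => Finset.sum_nonneg fun _ _ => abs_nonneg _
  have hM₂0 : 0 ≤ M₂ := Finset.sum_nonneg fun _ _ => by positivity
  have hb₁ : ∀ n f, n ≤ z → |confirmMean p q z χ n f| ≤ M₁ := by
    intro n f hn
    rcases lt_or_ge z f with hf | hf
    · rw [confirmMean_of_lt hf, abs_zero]
      exact hM₁0
    · refine le_trans ?_ (Finset.single_le_sum (f := fun n => ∑ f ∈ Finset.range (z + 1),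
        |confirmMean p q z χ n f|) (fun _ _ => Finset.sum_nonneg fun _ _ => abs_nonneg _)
        (Finset.mem_range.mpr (Nat.lt_succ_of_le hn)))
      exact Finset.single_le_sum (f := fun f => |confirmMean p q z χ n f|)
        (fun _ _ => abs_nonneg _) (Finset.mem_range.mpr (Nat.lt_succ_of_le hf))
  have hb₂ : ∀ d, d ≤ A + 1 → |w d| + |u d| ≤ M₂ := fun d hd =>
    Finset.single_le_sum (f := fun d => |w d| + |u d|) (fun _ _ => by positivity)
      (Finset.mem_range.mpr (Nat.lt_succ_of_le hd))
  refine ⟨D + M₁ + M₂, fun h f hs => ?_⟩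
  have hf0 : (0 : ℝ) ≤ f := f.cast_nonneg
  simp only [CycleEnds, not_or, not_and, not_le, not_lt] at hs
  by_cases hh : h < z
  · simp only [cycleValue, if_pos hh]
    calc _ ≤ |L h f| + |confirmMean p q z χ (z - h) f| := abs_add_le _ _
      _ ≤ D * (1 + f) + M₁ := add_le_add (hLD h f hh) (hb₁ _ _ (Nat.sub_le _ _))
      _ ≤ (D + M₁ + M₂) * (1 + f) := by nlinarith
  · have hfh := hs.2 (not_lt.mp hh)
    simp only [cycleValue, if_neg hh, if_pos (show f ≤ h ∧ h ≤ A + f by omega)]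
    have hd := hb₂ (h + 1 - f) (by omega)
    have h1 : |w (h + 1 - f)| ≤ M₂ := by linarith [abs_nonneg (u (h + 1 - f))]
    have h2 : |u (h + 1 - f)| ≤ M₂ := by linarith [abs_nonneg (w (h + 1 - f))]
    calc _ ≤ |(f : ℝ) * w (h + 1 - f)| + |u (h + 1 - f)| := abs_add_le _ _
      _ = f * |w (h + 1 - f)| + |u (h + 1 - f)| := by rw [abs_mul, abs_of_nonneg hf0]
      _ ≤ f * M₂ + M₂ := by gcongr
      _ ≤ (D + M₁ + M₂) * (1 + f) := by 
        nlinarith [mul_nonneg (add_nonneg hD hM₁0) (add_nonneg zero_le_one hf0)]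

variable {Ω : Type*} [MeasurableSpace Ω] {μ : Measure Ω} {X Y : ℕ → Ω → ℝ} {τ₀ c D : ℝ}

open Classical in
/-- The expectation of a linear combination of the duration of an attack cycle and of a reward that
is paid after a success and that depends on the length of the secret fork. -/
theorem integral_cycle_eq_cycleValue (hq0 : 0 < q) (hq : q < 1 / 2) (hp : p = 1 - q) (hτ₀ : 0 < τ₀)
    (hA : z ≤ A) (hrace : IsMiningRace μ p q τ₀ X Y) (hc : 0 ≤ c) (hφ : ∀ f : ℤ, 0 ≤ f → 0 ≤ φ f)
    (hL : ∀ h f, h < z → L h f = c * τ₀ + (p * L (h + 1) f + q * L h (f + 1)))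
    (hLz : ∀ f : ℕ, z < f → L z f = φ f) (hD : 0 ≤ D)
    (hLD : ∀ h f : ℕ, h < z → |L h f| ≤ D * (1 + f))
    (hw : ∀ d < A, w (d + 1) = p * w (d + 2) + q * w d) (hwA : w (A + 1) = 0)
    (hu : ∀ d < A, u (d + 1) = c * τ₀ + (p * u (d + 2) + q * (u d + w d))) (huA : u (A + 1) = 0)
    (h0 : ∀ f : ℕ, f * w 0 + u 0 = φ f) :
    Integrable (fun ω => c * cycleDuration A z X Y ω +
        if IsSuccess A z X Y ω then φ (secretFork Y (cycleDuration A z X Y ω) ω) else 0) μ ∧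
      ∫ ω, (c * cycleDuration A z X Y ω +
        if IsSuccess A z X Y ω then φ (secretFork Y (cycleDuration A z X Y ω) ω) else 0) ∂μ =
      c * τ₀ / q + (L 0 1 +
        confirmMean p q z (fun f => f * w (z + 1 - f) + u (z + 1 - f) - L z f) z 1) := by
  obtain ⟨C, hC⟩ := exists_bound_cycleValue (p := p) (q := q) (e := c * τ₀) (A := A) (w := w)
    (u := u) (φ := φ) hD hLD
  have h := integral_cycle (ρ := fun h f => if (z : ℤ) ≤ h ∧ h - f < 0 then φ f else 0)
    hq0 hq hp hτ₀ hrace hc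
    (fun h f => by
      split_ifs with hs
      · exact hφ f (by omega)
      · exact le_rfl)
    (fun h f hs => cycleValue_of_ends (L := L) (p := p) (q := q) (e := c * τ₀) hA hwA huA hs)
    (fun s hs => cycleValue_step hq0 hp hA hL hLz hw hu h0 hs) hC
  have e : ∀ ω, (if IsSuccess A z X Y ω then φ (secretFork Y (cycleDuration A z X Y ω) ω) else 0) =
      if (z : ℤ) ≤ confirmations X Y (cycleDuration A z X Y ω) ω ∧
        confirmations X Y (cycleDuration A z X Y ω) ω -
          secretFork Y (cycleDuration A z X Y ω) ω < 0
      then φ (secretFork Y (cycleDuration A z X Y ω) ω) else 0 := fun ω =>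
    if_congr Iff.rfl rfl rfl
  simp only [e]
  exact h

end Value

/-! ### Negative binomial sums. -/

section NegativeBinomial

/-- The distribution function of a negative binomial law: `x` is the probability of a success of
which `z` are awaited, `y` the probability of a failure, and there are fewer than `n` failures. -/
noncomputable def negBinSum (z n : ℕ) (x y : ℝ) : ℝ :=
  ∑ k ∈ Finset.range n, (z.multichoose k : ℝ) * x ^ z * y ^ k

lemma succ_mul_multichoose_succ {z : ℕ} (hz : 1 ≤ z) (k : ℕ) :
    ((k + 1 : ℕ) : ℝ) * (z.multichoose (k + 1) : ℝ) = (z + k) * z.multichoose k := by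
  rw [Nat.multichoose_eq, Nat.multichoose_eq, show z + (k + 1) - 1 = (z + k - 1) + 1 by omega]
  have h := Nat.add_one_mul_choose_eq (z + k - 1) k
  rw [show z + k - 1 + 1 = z + k by omega] at h ⊢
  have h' : (((z + k) * (z + k - 1).choose k : ℕ) : ℝ) = ((z + k).choose (k + 1) * (k + 1) : ℕ) := by
    rw [h]
  push_cast at h' ⊢
  linarith

/-- The derivative telescopes: that of the term `k = n` combines with the single term for `n` into
the single term for `n + 1`, by `succ_mul_multichoose_succ`. -/
lemma hasDerivAt_negBinSum {z : ℕ} (hz : 1 ≤ z) (n : ℕ) (x : ℝ) :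
    HasDerivAt (fun x => negBinSum z n x (1 - x))
      (n * z.multichoose n * x ^ (z - 1) * (1 - x) ^ (n - 1)) x := by
  induction n with
  | zero => simpa [negBinSum] using hasDerivAt_const x (0 : ℝ)
  | succ n ih =>
    have h1 : HasDerivAt (fun x : ℝ => 1 - x) (-1) x := by
      simpa using (hasDerivAt_id x).const_sub 1
    have h2 := (((hasDerivAt_pow z x).const_mul (z.multichoose n : ℝ)).mul (h1.pow n))
    have h3 := ih.add h2
    have e : (fun x => negBinSum z (n + 1) x (1 - x)) = (fun x => negBinSum z n x (1 - x)) +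
        (fun x => (z.multichoose n : ℝ) * x ^ z) * (fun x : ℝ => 1 - x) ^ n := by
      funext x
      simp [negBinSum, Finset.sum_range_succ]
    rw [e]
    refine h3.congr_deriv ?_
    rw [succ_mul_multichoose_succ hz]
    obtain ⟨m, rfl⟩ : ∃ m, z = m + 1 := ⟨z - 1, by omega⟩
    rcases n with _ | n
    · simp
    · simp only [Nat.add_sub_cancel, Pi.pow_apply]
      push_cast
      ring

/-- In repeated trials, either `z` successes precede the `z`-th failure or the reverse.
Analytically, the derivative for `n = z` is symmetric in `x` and `1 - x`, so the sum is constant; at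
`x = 0` only one term survives. -/
lemma negBinSum_add_negBinSum {z : ℕ} (hz : 1 ≤ z) (x : ℝ) :
    negBinSum z z x (1 - x) + negBinSum z z (1 - x) x = 1 := by
  have hd : ∀ x, HasDerivAt (fun x => negBinSum z z x (1 - x) + negBinSum z z (1 - x) x) 0 x := by
    intro x
    have h1 : HasDerivAt (fun x : ℝ => 1 - x) (-1) x := by
      simpa using (hasDerivAt_id x).const_sub 1
    have h2 := (hasDerivAt_negBinSum hz z (1 - x)).comp x h1
    have h3 := (hasDerivAt_negBinSum hz z x).add h2
    have e : (fun x => negBinSum z z x (1 - x) + negBinSum z z (1 - x) x) =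
        (fun x => negBinSum z z x (1 - x)) +
          ((fun x => negBinSum z z x (1 - x)) ∘ fun x => 1 - x) := by
      funext x
      simp
    rw [e]
    refine h3.congr_deriv ?_
    rw [sub_sub_cancel]
    ring
  have hc := is_const_of_deriv_eq_zero (fun x => (hd x).differentiableAt) (fun x => (hd x).deriv) x 0
  refine hc.trans ?_
  obtain ⟨m, rfl⟩ : ∃ m, z = m + 1 := ⟨z - 1, by omega⟩
  simp only [negBinSum]
  rw [Finset.sum_range_succ' (fun k => ((m + 1).multichoose k : ℝ) * (1 - 0) ^ (m + 1) * 0 ^ k)]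
  simp

/-- The truncated mean is the full mean `z y / (1 - y)` times the distribution function, up to one
boundary term. -/
lemma sum_mul_negBin {z : ℕ} (hz : 1 ≤ z) (n : ℕ) (y : ℝ) :
    (1 - y) * ∑ k ∈ Finset.range n, (k : ℝ) * (z.multichoose k * (1 - y) ^ z * y ^ k) =
      y * z * negBinSum z n (1 - y) y - n * z.multichoose n * (1 - y) ^ z * y ^ n := by
  induction n with
  | zero => simp [negBinSum]
  | succ n ih =>
    have h : negBinSum z (n + 1) (1 - y) y =
        negBinSum z n (1 - y) y + z.multichoose n * (1 - y) ^ z * y ^ n := by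
      rw [negBinSum, Finset.sum_range_succ, ← negBinSum]
    rw [Finset.sum_range_succ, mul_add, ih, h, succ_mul_multichoose_succ hz]
    ring

lemma inv_beta_self {z : ℕ} (hz : 1 ≤ z) : 1 / beta (z : ℝ) z = z * z.multichoose z := by
  obtain ⟨m, rfl⟩ : ∃ m, z = m + 1 := ⟨z - 1, by omega⟩
  have h1 : Real.Gamma ((m + 1 : ℕ) : ℝ) = (m.factorial : ℝ) := by
    push_cast
    exact Real.Gamma_nat_eq_factorial m
  have h2 : Real.Gamma (((m + 1 : ℕ) : ℝ) + ((m + 1 : ℕ) : ℝ)) = ((2 * m + 1).factorial : ℝ) := by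
    rw [← Real.Gamma_nat_eq_factorial]
    congr 1
    push_cast
    ring
  have h3 := Nat.choose_mul_factorial_mul_factorial (show m + 1 ≤ 2 * m + 1 by omega)
  rw [show 2 * m + 1 - (m + 1) = m by omega] at h3
  rw [beta, h1, h2, ← h3, Nat.multichoose_eq, show m + 1 + (m + 1) - 1 = 2 * m + 1 by omega,
    Nat.factorial_succ]
  have := Nat.factorial_ne_zero m
  push_cast
  field_simp

end NegativeBinomial

/-! ### The regularized incomplete Beta function. -/

section IncompleteBeta

variable {a b x : ℝ}

lemma regIncBeta_eq (x a b : ℝ) :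
    regIncBeta x a b = 1 / beta a b * ∫ t in (0 : ℝ)..x, t ^ (a - 1) * (1 - t) ^ (b - 1) := by
  rw [regIncBeta, beta, one_div_div]

/-- The normalization of the Beta density takes care of the endpoint singularity, which is present
here for the exponent `1/2 - 1`. -/
lemma integrableOn_beta (ha : 0 < a) (hb : 0 < b) :
    IntegrableOn (fun t : ℝ => t ^ (a - 1) * (1 - t) ^ (b - 1)) (Set.Ioo 0 1) := by
  have h := lintegral_betaPDF_eq_one ha hb
  rw [lintegral_betaPDF] at h
  have hB := beta_pos ha hb
  have hm : Measurable fun t : ℝ => t ^ (a - 1) * (1 - t) ^ (b - 1) := by fun_prop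
  have hi : IntegrableOn (fun t : ℝ => 1 / beta a b * t ^ (a - 1) * (1 - t) ^ (b - 1))
      (Set.Ioo 0 1) := by
    refine ⟨Measurable.aestronglyMeasurable (by fun_prop), ?_⟩
    rw [hasFiniteIntegral_iff_ofReal]
    · rw [h]; exact ENNReal.one_lt_top
    · refine ae_restrict_of_forall_mem measurableSet_Ioo fun t ht => ?_
      have h1 : 0 ≤ t ^ (a - 1) := Real.rpow_nonneg ht.1.le _
      have h2 : 0 ≤ (1 - t) ^ (b - 1) := Real.rpow_nonneg (by linarith [ht.2]) _
      simp only [Pi.zero_apply]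
      positivity
  refine (hi.const_mul (beta a b)).congr (Filter.Eventually.of_forall fun t => ?_)
  simp only
  field_simp

lemma integral_beta (ha : 0 < a) (hb : 0 < b) :
    ∫ t in (0 : ℝ)..1, t ^ (a - 1) * (1 - t) ^ (b - 1) = beta a b := by
  have h := lintegral_betaPDF_eq_one ha hb
  rw [lintegral_betaPDF] at h
  have hB := beta_pos ha hb
  have hi := (integrableOn_beta ha hb).const_mul (1 / beta a b)
  have hnn : 0 ≤ᵐ[volume.restrict (Set.Ioo 0 1)]
      fun t : ℝ => 1 / beta a b * (t ^ (a - 1) * (1 - t) ^ (b - 1)) := by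
    refine ae_restrict_of_forall_mem measurableSet_Ioo fun t ht => ?_
    have h1 : 0 ≤ t ^ (a - 1) := Real.rpow_nonneg ht.1.le _
    have h2 : 0 ≤ (1 - t) ^ (b - 1) := Real.rpow_nonneg (by linarith [ht.2]) _
    simp only [Pi.zero_apply]
    positivity
  have h1 := integral_eq_lintegral_of_nonneg_ae hnn hi.aestronglyMeasurable
  simp only [← mul_assoc] at h1
  rw [h] at h1
  simp only [mul_assoc, integral_const_mul] at h1
  rw [intervalIntegral.integral_of_le zero_le_one, integral_Ioc_eq_integral_Ioo]
  field_simp at h1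
  simpa using h1

lemma regIncBeta_add_regIncBeta (ha : 0 < a) (hb : 0 < b) (hx0 : 0 ≤ x) (hx1 : x ≤ 1) :
    regIncBeta x a b + regIncBeta (1 - x) b a = 1 := by
  have hB := beta_pos ha hb
  have hsymm : beta b a = beta a b := by rw [beta, beta, add_comm, mul_comm (Real.Gamma b)]
  have hI : IntervalIntegrable (fun t : ℝ => t ^ (a - 1) * (1 - t) ^ (b - 1)) volume 0 1 := by
    rw [intervalIntegrable_iff_integrableOn_Ioo_of_le zero_le_one]
    exact integrableOn_beta ha hb
  have h1 : ∫ t in (0 : ℝ)..(1 - x), t ^ (b - 1) * (1 - t) ^ (a - 1) =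
      ∫ t in x..1, t ^ (a - 1) * (1 - t) ^ (b - 1) := by
    have := intervalIntegral.integral_comp_sub_left
      (fun t : ℝ => t ^ (a - 1) * (1 - t) ^ (b - 1)) (1 : ℝ) (a := 0) (b := 1 - x)
    simp only [sub_sub_cancel, sub_zero] at this
    rw [← this]
    exact intervalIntegral.integral_congr fun t _ => mul_comm _ _
  rw [regIncBeta_eq, regIncBeta_eq, hsymm, h1, ← mul_add,
    intervalIntegral.integral_add_adjacent_intervals (hI.mono_set ?_) (hI.mono_set ?_),
    integral_beta ha hb, one_div_mul_cancel hB.ne']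
  · rw [Set.uIcc_of_le hx0, Set.uIcc_of_le zero_le_one]
    exact Set.Icc_subset_Icc_right hx1
  · rw [Set.uIcc_of_le hx1, Set.uIcc_of_le zero_le_one]
    exact Set.Icc_subset_Icc_left hx0

/-- This is Legendre's duplication formula. -/
lemma inv_beta_half_mul {z : ℕ} (hz : 1 ≤ z) :
    1 / beta (z : ℝ) (1 / 2) * 4 ^ z = 2 * (1 / beta (z : ℝ) z) := by
  have hz0 : (0 : ℝ) < z := by exact_mod_cast hz
  have h := Real.Gamma_mul_Gamma_add_half (z : ℝ)
  have h1 := Real.Gamma_pos_of_pos hz0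
  have h2 : 0 < Real.Gamma ((z : ℝ) + 1 / 2) := Real.Gamma_pos_of_pos (by positivity)
  have h3 : 0 < Real.Gamma (2 * (z : ℝ)) := Real.Gamma_pos_of_pos (by positivity)
  have hπ : 0 < √Real.pi := Real.sqrt_pos.mpr Real.pi_pos
  have hpow : (2 : ℝ) ^ (1 - 2 * (z : ℝ)) = 2 / 4 ^ z := by
    rw [Real.rpow_sub two_pos, Real.rpow_one, Real.rpow_mul (by norm_num), Real.rpow_natCast]
    norm_num
  rw [hpow] at h
  rw [beta, beta, Real.Gamma_one_half_eq, ← two_mul]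
  field_simp at h ⊢
  linarith

/-- The symmetric value of the incomplete Beta function as the distribution function of a negative
binomial law. -/
theorem regIncBeta_eq_negBinSum {z : ℕ} (hz : 1 ≤ z) {q : ℝ} (hq0 : 0 < q) (hq : q < 1 / 2) :
    regIncBeta (4 * (1 - q) * q) z (1 / 2) = 2 * negBinSum z z q (1 - q) := by
  have hpoly : ∫ u in (0 : ℝ)..q, (z * z.multichoose z * u ^ (z - 1) * (1 - u) ^ (z - 1) : ℝ) =
      negBinSum z z q (1 - q) := by
    rw [intervalIntegral.integral_eq_sub_of_hasDerivAt
      (fun u _ => hasDerivAt_negBinSum hz z u) ?_]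
    · simp [negBinSum, show z ≠ 0 by omega]
    · exact Continuous.intervalIntegrable (by fun_prop) _ _
  -- The map `u ↦ 4u(1-u)` increases on `[0, q]` because `q < 1/2`. Since `1 - 4u(1-u) = (1 -
  -- 2u)^2`, the factor `(1 - t)^(-1/2)` cancels the derivative `4(1 - 2u)` up to 4.
  have hsub := intervalIntegral.integral_comp_mul_deriv_of_deriv_nonneg (a := 0) (b := q)
    (f := fun u : ℝ => 4 * (1 - u) * u) (f' := fun u => 4 * (1 - 2 * u))
    (g := fun t : ℝ => t ^ ((z : ℝ) - 1) * (1 - t) ^ ((1 / 2 : ℝ) - 1))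
    (by fun_prop)
    (fun u _ => by
      have h1 := (((hasDerivAt_id u).const_sub 1).const_mul 4).mul (hasDerivAt_id u)
      refine h1.congr_deriv ?_
      simp only [id]
      ring)
    (fun u hu => by
      rw [max_eq_right hq0.le] at hu
      linarith [hu.2])
  have hval : ∫ u in (0 : ℝ)..q, ((fun t : ℝ => t ^ ((z : ℝ) - 1) * (1 - t) ^ ((1 / 2 : ℝ) - 1)) ∘
      fun u : ℝ => 4 * (1 - u) * u) u * (4 * (1 - 2 * u)) =
      4 ^ z / (z * z.multichoose z) * negBinSum z z q (1 - q) := by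
    rw [← hpoly, ← intervalIntegral.integral_const_mul]
    refine intervalIntegral.integral_congr fun u hu => ?_
    rw [Set.uIcc_of_le hq0.le] at hu
    have hu1 : 0 < 1 - 2 * u := by linarith [hu.2]
    have hz0 : (z : ℝ) ≠ 0 := by exact_mod_cast (show z ≠ 0 by omega)
    have hm0 : (z.multichoose z : ℝ) ≠ 0 := by
      rw [Nat.multichoose_eq]
      exact_mod_cast (Nat.choose_pos (by omega)).ne'
    have e1 : (1 - 4 * (1 - u) * u) ^ ((1 / 2 : ℝ) - 1) = (1 - 2 * u)⁻¹ := by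
      rw [show 1 - 4 * (1 - u) * u = (1 - 2 * u) ^ (2 : ℝ) by rw [Real.rpow_two]; ring,
        ← Real.rpow_mul hu1.le, ← Real.rpow_neg_one]
      norm_num
    have e2 : (4 * (1 - u) * u) ^ ((z : ℝ) - 1) = (4 * (1 - u) * u) ^ (z - 1) := by
      rw [← Real.rpow_natCast, Nat.cast_sub hz, Nat.cast_one]
    simp only [Function.comp_apply]
    rw [e1, e2, mul_pow, mul_pow]
    have e3 : (4 : ℝ) ^ z = 4 ^ (z - 1) * 4 := by rw [← pow_succ, Nat.sub_add_cancel hz]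
    have e4 : (1 - 2 * u)⁻¹ * (4 * (1 - 2 * u)) = 4 := by
      rw [mul_comm, mul_assoc, mul_inv_cancel₀ hu1.ne', mul_one]
    rw [mul_assoc, e4, e3]
    field_simp
  rw [hval] at hsub
  simp only [mul_zero] at hsub
  rw [regIncBeta_eq, ← hsub]
  have hB := inv_beta_half_mul hz
  have hz0 : (z : ℝ) ≠ 0 := by exact_mod_cast (show z ≠ 0 by omega)
  have hm0 : (z.multichoose z : ℝ) ≠ 0 := by
    rw [Nat.multichoose_eq]
    exact_mod_cast (Nat.choose_pos (by omega)).ne'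
  rw [inv_beta_self hz] at hB
  calc _ = 1 / beta (z : ℝ) (1 / 2) * 4 ^ z / (z * z.multichoose z) * negBinSum z z q (1 - q) := by
        ring
    _ = _ := by
        rw [hB]
        field_simp

end IncompleteBeta

/-! ### Gambler's ruin. -/

section Ruin

/-- The probability that a gambler who plays with the odds `lam` and who lacks `d` points reaches his
goal before he lacks `N` points. -/
noncomputable def ruinProb (lam : ℝ) (N d : ℕ) : ℝ := (lam ^ d - lam ^ N) / (1 - lam ^ N)

/-- The expected number of the gambler's points if he reaches his goal, and `0` otherwise. -/
noncomputable def ruinGain (p q lam : ℝ) (N d : ℕ) : ℝ :=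
  (q * lam ^ N * d + p * d * lam ^ d - N * lam ^ N / (1 - lam ^ N) * (1 - lam ^ d)) /
    ((p - q) * (1 - lam ^ N))

/-- The expected duration of the gambler's game. -/
noncomputable def ruinTime (p q lam : ℝ) (N d : ℕ) : ℝ :=
  (N * ((1 - lam ^ d) / (1 - lam ^ N)) - d) / (p - q)

variable {p q lam : ℝ} {N : ℕ}

lemma ruinProb_succ (hq0 : 0 < q) (hq : q < 1 / 2) (hp : p = 1 - q) (hlam : lam = q / p) (d : ℕ) :
    ruinProb lam N (d + 1) = p * ruinProb lam N (d + 2) + q * ruinProb lam N d := by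
  have hp0 : 0 < p := by linarith
  have hql : q = lam * p := by rw [hlam]; field_simp
  have h1 : p * (1 + lam) = 1 := by linarith
  simp only [ruinProb]
  rw [← mul_div_assoc, ← mul_div_assoc, ← add_div]
  congr 1
  rw [hql]
  linear_combination (lam ^ N - lam ^ (d + 1)) * h1

lemma one_sub_pow_pos (hlam0 : 0 < lam) (hlam1 : lam < 1) (hN : N ≠ 0) : 0 < 1 - lam ^ N :=
  sub_pos.mpr (pow_lt_one₀ hlam0.le hlam1 hN)

/-- The source `q * ruinProb` is a combination of the homogeneous solutions `1` and `λ^d`; this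
resonance explains the terms in `d` and `d λ^d`. -/
lemma ruinGain_succ (hq0 : 0 < q) (hq : q < 1 / 2) (hp : p = 1 - q) (hlam : lam = q / p)
    (hN : 0 < 1 - lam ^ N) (d : ℕ) :
    ruinGain p q lam N (d + 1) = 0 + (p * ruinGain p q lam N (d + 2) +
      q * (ruinGain p q lam N d + ruinProb lam N d)) := by
  have hp0 : 0 < p := by linarith
  have hpq : 0 < p - q := by linarith
  have hql : q = lam * p := by rw [hlam]; field_simp
  have h1 : p = 1 / (1 + lam) := by
    have : p * (1 + lam) = 1 := by linarith
    have h2 : 1 + lam ≠ 0 := fun h => by simp [h] at this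
    field_simp
    linarith
  have hl : 0 < lam := by rw [hlam]; positivity
  have hl1 : 1 - lam ≠ 0 := fun h => by
    have : p - q = p * (1 - lam) := by rw [hql]; ring
    rw [this, h, mul_zero] at hpq
    exact lt_irrefl _ hpq
  simp only [ruinGain, ruinProb]
  rw [hql, h1]
  -- With `p` and `q` eliminated, the claim is a rational identity in `λ`, `λ^d`, `d`, `N` and `Λ`.
  generalize lam ^ N = Λ at *
  have e : 1 / (1 + lam) - lam * (1 / (1 + lam)) = (1 - lam) / (1 + lam) := by field_simp
  rw [e]
  push_cast
  field_simp
  ring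

/-- Behind the formula is Wald's identity: the lack drifts by `p - q` per block and ends at `N` with
probability `(1 - λ^d) / (1 - λ^N)`, otherwise at `0`. -/
lemma ruinTime_succ (hq0 : 0 < q) (hq : q < 1 / 2) (hp : p = 1 - q) (hlam : lam = q / p)
    (hN : 0 < 1 - lam ^ N) (d : ℕ) :
    ruinTime p q lam N (d + 1) = 1 + (p * ruinTime p q lam N (d + 2) +
      q * ruinTime p q lam N d) := by
  have hp0 : 0 < p := by linarith
  have hpq : 0 < p - q := by linarith
  have hql : q = lam * p := by rw [hlam]; field_simp
  have h1 : p = 1 / (1 + lam) := by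
    have : p * (1 + lam) = 1 := by linarith
    have h2 : 1 + lam ≠ 0 := fun h => by simp [h] at this
    field_simp
    linarith
  have hl : 0 < lam := by rw [hlam]; positivity
  have hl1 : 1 - lam ≠ 0 := fun h => by
    have : p - q = p * (1 - lam) := by rw [hql]; ring
    rw [this, h, mul_zero] at hpq
    exact lt_irrefl _ hpq
  simp only [ruinTime]
  rw [hql, h1]
  generalize lam ^ N = Λ at *
  have e : 1 / (1 + lam) - lam * (1 / (1 + lam)) = (1 - lam) / (1 + lam) := by field_simp
  rw [e]
  push_cast
  field_simp
  ring

end Ruin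

/-! ### Averaging over the blocks mined before the last confirmation. -/

section Sums

variable {p q lam : ℝ} {z : ℕ}

/-- For `k + d = z`, the factor `λ^d` turns the weight `p^z q^k` into `q^z p^k`, exchanging the two
miners. -/
lemma confirmMean_eq (hp0 : 0 < p) (hlam : lam = q / p) {χ : ℕ → ℝ} {c₁ c₂ c₃ c₄ : ℝ}
    (hχ : ∀ k d : ℕ, k + d = z →
      χ (1 + k) = c₁ + c₂ * lam ^ d + k * (c₃ + c₄ * lam ^ d)) :
    confirmMean p q z χ z 1 = c₁ * negBinSum z z p q + c₂ * negBinSum z z q p +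
      c₃ * ∑ k ∈ Finset.range z, (k : ℝ) * (z.multichoose k * p ^ z * q ^ k) +
      c₄ * ∑ k ∈ Finset.range z, (k : ℝ) * (z.multichoose k * q ^ z * p ^ k) := by
  rw [confirmMean, Nat.add_sub_cancel, negBinSum, negBinSum, Finset.mul_sum, Finset.mul_sum,
    Finset.mul_sum, Finset.mul_sum, ← Finset.sum_add_distrib, ← Finset.sum_add_distrib,
    ← Finset.sum_add_distrib]
  refine Finset.sum_congr rfl fun k hk => ?_
  obtain ⟨d, hd⟩ : ∃ d, k + d = z := ⟨z - k, by have := Finset.mem_range.mp hk; omega⟩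
  have e : p ^ z * q ^ k * lam ^ d = q ^ z * p ^ k := by
    rw [hlam, div_pow, ← hd, pow_add, pow_add]
    field_simp
  rw [hχ k d hd]
  linear_combination (z.multichoose k : ℝ) * (c₂ + k * c₄) * e

end Sums

/-! ### The three expectations. -/

section Expectations

variable {p q lam τ₀ : ℝ} {z A : ℕ}
variable {Ω : Type*} [MeasurableSpace Ω] {μ : Measure Ω} {X Y : ℕ → Ω → ℝ}

lemma sum_mul_negBin_eq (hq0 : 0 < q) (hq : q < 1 / 2) (hp : p = 1 - q) (hz : 1 ≤ z) :
    ∑ k ∈ Finset.range z, (k : ℝ) * (z.multichoose k * p ^ z * q ^ k) =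
        z * q / p * (1 - negBinSum z z q p) - p ^ (z - 1) * q ^ z / beta (z : ℝ) z ∧
      ∑ k ∈ Finset.range z, (k : ℝ) * (z.multichoose k * q ^ z * p ^ k) =
        z * p / q * negBinSum z z q p - p / q * (p ^ (z - 1) * q ^ z / beta (z : ℝ) z) := by
  have hp0 : 0 < p := by linarith
  have hB := inv_beta_self hz
  have hpp : p ^ z = p ^ (z - 1) * p := by rw [← pow_succ, Nat.sub_add_cancel hz]
  have hc : p ^ (z - 1) * q ^ z / beta (z : ℝ) z = z * z.multichoose z * p ^ (z - 1) * q ^ z := by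
    rw [div_eq_mul_one_div, hB]; ring
  have h0 := negBinSum_add_negBinSum hz q
  have h1 := sum_mul_negBin hz z q
  have h2 := sum_mul_negBin hz z p
  rw [← hp] at h0 h1
  rw [show (1 : ℝ) - p = q by linarith] at h2
  rw [hc]
  constructor
  · rw [show 1 - negBinSum z z q p = negBinSum z z p q by linarith]
    apply mul_left_cancel₀ hp0.ne'
    rw [h1, hpp]
    field_simp
  · apply mul_left_cancel₀ hq0.ne'
    rw [h2, hpp]
    field_simp

open Classical in
theorem integral_success (hq0 : 0 < q) (hq : q < 1 / 2) (hp : p = 1 - q) (hlam : lam = q / p)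
    (hτ₀ : 0 < τ₀) (hz : 1 ≤ z) (hA : z ≤ A) (hrace : IsMiningRace μ p q τ₀ X Y) :
    Integrable (fun ω => if IsSuccess A z X Y ω then (1 : ℝ) else 0) μ ∧
      ∫ ω, (if IsSuccess A z X Y ω then (1 : ℝ) else 0) ∂μ =
        (2 * negBinSum z z q p - lam ^ (A + 1)) / (1 - lam ^ (A + 1)) := by
  have hp0 : 0 < p := by linarith
  have hl0 : 0 < lam := by rw [hlam]; positivity
  have hl1 : lam < 1 := by rw [hlam, div_lt_one hp0]; linarith
  have hR := one_sub_pow_pos hl0 hl1 A.succ_ne_zero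
  -- Reward 1 and no charge: the reward does not depend on `f`, so `w = 0` and `u` is the ruin
  -- probability.
  have h := integral_cycle_eq_cycleValue (c := 0) (D := 1) (φ := fun _ => 1) (L := fun _ _ => 1)
    (w := fun _ => 0) (u := ruinProb lam (A + 1)) hq0 hq hp hτ₀ hA hrace le_rfl
    (fun _ _ => zero_le_one) (fun _ _ _ => by rw [hp]; ring) (fun _ _ => rfl) zero_le_one
    (fun _ f _ => by rw [abs_one, one_mul]; linarith [f.cast_nonneg (α := ℝ)])
    (fun _ _ => by ring) rfl
    (fun d _ => by rw [ruinProb_succ hq0 hq hp hlam d]; ring)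
    (by simp [ruinProb])
    (fun f => by simp [ruinProb, hR.ne'])
  rw [confirmMean_eq hp0 hlam (c₁ := -1 / (1 - lam ^ (A + 1))) (c₂ := 1 / (1 - lam ^ (A + 1)))
    (c₃ := 0) (c₄ := 0)] at h
  · simp only [zero_mul, zero_add, zero_div, add_zero] at h
    refine ⟨h.1, h.2.trans ?_⟩
    have h0 := negBinSum_add_negBinSum hz q
    rw [← hp] at h0
    rw [show negBinSum z z p q = 1 - negBinSum z z q p by linarith]
    field_simp
    ring
  · intro k d hd
    rw [show z + 1 - (1 + k) = d by omega, ruinProb]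
    field_simp
    ring

open Classical in
theorem integral_fork (hq0 : 0 < q) (hq : q < 1 / 2) (hp : p = 1 - q) (hlam : lam = q / p)
    (hτ₀ : 0 < τ₀) (hz : 1 ≤ z) (hA : z ≤ A) (hrace : IsMiningRace μ p q τ₀ X Y) :
    Integrable (fun ω => if IsSuccess A z X Y ω then
        (secretFork Y (cycleDuration A z X Y ω) ω : ℝ) else 0) μ ∧
      ∫ ω, (if IsSuccess A z X Y ω then
        (secretFork Y (cycleDuration A z X Y ω) ω : ℝ) else 0) ∂μ =
      q * z / p * negBinSum z z q p
        - (A + 1) * lam ^ (A + 1) / (p * (1 - lam) ^ 3 * lamBracket lam (A + 1) ^ 2)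
          * (1 - 2 * negBinSum z z q p)
        + (2 - lam + lam ^ (A + 2)) / ((1 - lam) ^ 2 * lamBracket lam (A + 1))
          * (p ^ (z - 1) * q ^ z / beta z z)
        + (2 * negBinSum z z q p - lam ^ (A + 1)) / (1 - lam ^ (A + 1)) := by
  have hp0 : 0 < p := by linarith
  have hpq : 0 < p - q := by linarith
  have hl0 : 0 < lam := by rw [hlam]; positivity
  have hl1 : lam < 1 := by rw [hlam, div_lt_one hp0]; linarith
  have hl1' : 0 < 1 - lam := by linarith
  have hR := one_sub_pow_pos hl0 hl1 A.succ_ne_zero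
  -- Reward `f`: `L` adds `q / p` expected attacker's blocks for each missing confirmation.
  have h := integral_cycle_eq_cycleValue (c := 0) (D := 1 + z * q / p) (φ := fun f => f)
    (L := fun h f => f + (z - h) * q / p)
    (w := ruinProb lam (A + 1)) (u := ruinGain p q lam (A + 1)) hq0 hq hp hτ₀ hA hrace le_rfl
    (fun f hf => by exact_mod_cast hf)
    (fun h f _ => by
      push_cast
      rw [hp]
      have : 1 - q ≠ 0 := by linarith
      field_simp
      ring)
    (fun f _ => by simp) (by positivity)
    (fun h f hh => by
      have h1 : (h : ℝ) ≤ z := by exact_mod_cast hh.le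
      have h2 : (0 : ℝ) ≤ h := h.cast_nonneg
      have h3 : (0 : ℝ) ≤ f := f.cast_nonneg
      have h4 : 0 ≤ ((z : ℝ) - h) * q / p := by
        have : 0 ≤ (z : ℝ) - h := by linarith
        positivity
      have h5 : ((z : ℝ) - h) * q / p ≤ z * q / p := by gcongr; linarith
      have h6 : 0 ≤ z * q / p * f := by positivity
      rw [abs_of_nonneg (by positivity)]
      linarith)
    (fun d _ => ruinProb_succ hq0 hq hp hlam d) (by simp [ruinProb])
    (fun d _ => by rw [ruinGain_succ hq0 hq hp hlam hR d]; ring)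
    (by
      have : (1 : ℝ) - lam ^ (A + 1) ≠ 0 := hR.ne'
      rw [ruinGain, div_mul_cancel₀ _ this, div_eq_zero_iff]
      left
      have e : q + p = 1 := by rw [hp]; ring
      linear_combination ((A + 1 : ℕ) : ℝ) * lam ^ (A + 1) * e)
    (fun f => by simp [ruinProb, ruinGain, hR.ne'])
  obtain ⟨hs1, hs2⟩ := sum_mul_negBin_eq hq0 hq hp hz
  have h0 := negBinSum_add_negBinSum hz q
  rw [← hp] at h0
  -- The coefficients of `1`, `λ^d`, `k` and `k λ^d` in `f w(d) + u(d) - f`, where `f = 1 + k` and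
  -- `d = z - k`.
  rw [confirmMean_eq hp0 hlam
    (c₁ := -1 / (1 - lam ^ (A + 1)) + (q * lam ^ (A + 1) * z -
      (A + 1) * lam ^ (A + 1) / (1 - lam ^ (A + 1))) / ((p - q) * (1 - lam ^ (A + 1))))
    (c₂ := 1 / (1 - lam ^ (A + 1)) + (p * z +
      (A + 1) * lam ^ (A + 1) / (1 - lam ^ (A + 1))) / ((p - q) * (1 - lam ^ (A + 1))))
    (c₃ := -1 / (1 - lam ^ (A + 1)) - q * lam ^ (A + 1) / ((p - q) * (1 - lam ^ (A + 1))))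
    (c₄ := 1 / (1 - lam ^ (A + 1)) - p / ((p - q) * (1 - lam ^ (A + 1)))), hs1, hs2,
    show negBinSum z z p q = 1 - negBinSum z z q p by linarith] at h
  · simp only [zero_mul, zero_add, zero_div] at h
    refine ⟨h.1, h.2.trans ?_⟩
    rw [lamBracket, show lam ^ (A + 2) = lam ^ (A + 1) * lam from pow_succ _ _]
    generalize negBinSum z z q p = T
    generalize p ^ (z - 1) * q ^ z / beta (z : ℝ) z = κ
    generalize lam ^ (A + 1) = Λ at *
    have hql : q = lam * p := by rw [hlam]; field_simp
    have h1 : p = 1 / (1 + lam) := by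
      field_simp
      linarith
    rw [hql, h1]
    have e : 1 / (1 + lam) - lam * (1 / (1 + lam)) = (1 - lam) / (1 + lam) := by field_simp
    rw [e]
    push_cast
    field_simp
    ring
  · intro k d hd
    rw [show z + 1 - (1 + k) = d by omega, ruinProb, ruinGain, ← hd]
    push_cast
    field_simp
    ring

theorem integral_cycleDuration (hq0 : 0 < q) (hq : q < 1 / 2) (hp : p = 1 - q) (hlam : lam = q / p)
    (hτ₀ : 0 < τ₀) (hz : 1 ≤ z) (hA : z ≤ A) (hrace : IsMiningRace μ p q τ₀ X Y) :
    Integrable (cycleDuration A z X Y) μ ∧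
      ∫ ω, cycleDuration A z X Y ω ∂μ = τ₀ * (z / p * negBinSum z z q p
        + (A + 1) / (p * (1 - lam) ^ 2 * lamBracket lam (A + 1)) * (1 - 2 * negBinSum z z q p)
        - p ^ (z - 1) * q ^ z / (p * (1 - lam) * beta z z) + 1 / q) := by
  have hp0 : 0 < p := by linarith
  have hpq : 0 < p - q := by linarith
  have hl0 : 0 < lam := by rw [hlam]; positivity
  have hl1 : lam < 1 := by rw [hlam, div_lt_one hp0]; linarith
  have hl1' : 0 < 1 - lam := by linarith
  have hR := one_sub_pow_pos hl0 hl1 A.succ_ne_zero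
  -- Unit charge for time and no reward; each missing confirmation takes `τ₀ / p` on average.
  have h := integral_cycle_eq_cycleValue (c := 1) (D := τ₀ * z / p) (φ := fun _ => 0)
    (L := fun h _ => τ₀ * (z - h) / p)
    (w := fun _ => 0) (u := fun d => τ₀ * ruinTime p q lam (A + 1) d) hq0 hq hp hτ₀ hA hrace
    zero_le_one (fun _ _ => le_rfl)
    (fun h f _ => by
      push_cast
      rw [hp]
      have : 1 - q ≠ 0 := by linarith
      field_simp
      ring)
    (fun f _ => by simp) (by positivity)
    (fun h f hh => by
      have h1 : (h : ℝ) ≤ z := by exact_mod_cast hh.le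
      have h2 : (0 : ℝ) ≤ h := h.cast_nonneg
      have h3 : (0 : ℝ) ≤ f := f.cast_nonneg
      have h4 : 0 ≤ (z : ℝ) - h := by linarith
      have h5 : τ₀ * ((z : ℝ) - h) / p ≤ τ₀ * z / p := by gcongr; linarith
      have h6 : 0 ≤ τ₀ * z / p * f := by positivity
      rw [abs_of_nonneg (by positivity)]
      linarith)
    (fun _ _ => by ring) rfl
    (fun d _ => by rw [ruinTime_succ hq0 hq hp hlam hR d]; ring)
    (by simp [ruinTime, hR.ne'])
    (fun f => by simp [ruinTime])
  obtain ⟨hs1, -⟩ := sum_mul_negBin_eq hq0 hq hp hz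
  have h0 := negBinSum_add_negBinSum hz q
  rw [← hp] at h0
  rw [confirmMean_eq hp0 hlam
    (c₁ := τ₀ * ((A + 1) / (1 - lam ^ (A + 1)) - z) / (p - q))
    (c₂ := -τ₀ * (A + 1) / (1 - lam ^ (A + 1)) / (p - q)) (c₃ := τ₀ / (p - q)) (c₄ := 0), hs1,
    show negBinSum z z p q = 1 - negBinSum z z q p by linarith] at h
  · simp only [one_mul, ite_self, add_zero, zero_mul] at h
    refine ⟨h.1, h.2.trans ?_⟩
    rw [lamBracket, ← div_div _ _ (beta (z : ℝ) z), div_right_comm _ (p * (1 - lam))]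
    generalize negBinSum z z q p = T
    generalize p ^ (z - 1) * q ^ z / beta (z : ℝ) z = κ
    generalize lam ^ (A + 1) = Λ at *
    have hql : q = lam * p := by rw [hlam]; field_simp
    have h1 : p = 1 / (1 + lam) := by
      field_simp
      linarith
    rw [hql, h1]
    have e : 1 / (1 + lam) - lam * (1 / (1 + lam)) = (1 - lam) / (1 + lam) := by field_simp
    rw [e]
    push_cast
    field_simp
    ring
  · intro k d hd
    rw [show z + 1 - (1 + k) = d by omega, ruinTime, ← hd]
    push_cast
    field_simp
    ring

end Expectations

/-! ### Revenue, success probability and the final formulas. -/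

section Revenue

variable {p q lam τ₀ v b : ℝ} {z A : ℕ}
variable {Ω : Type*} {X Y : ℕ → Ω → ℝ}

open Classical in
lemma revenue_eq (ω : Ω) : revenue A z v b X Y ω =
    v * (if IsSuccess A z X Y ω then (1 : ℝ) else 0) +
      b * if IsSuccess A z X Y ω then (secretFork Y (cycleDuration A z X Y ω) ω : ℝ) else 0 := by
  by_cases hs : IsSuccess A z X Y ω <;> simp [revenue, hs]

variable [MeasurableSpace Ω] {μ : Measure Ω}

/-- A cycle lasts at least as long as its pre-mining, which is almost surely positive. -/
lemma integral_cycleDuration_pos (hq0 : 0 < q) (hq : q < 1 / 2) (hp : p = 1 - q)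
    (hlam : lam = q / p) (hτ₀ : 0 < τ₀) (hz : 1 ≤ z) (hA : z ≤ A)
    (hrace : IsMiningRace μ p q τ₀ X Y) : 0 < ∫ ω, cycleDuration A z X Y ω ∂μ := by
  have hb : 0 < q / τ₀ := by positivity
  have := hrace.indep.isProbabilityMeasure
  have hY : ∀ᵐ ω ∂μ, 0 < Y 0 ω := by
    have h : ∀ᵐ t ∂(expMeasure (q / τ₀)), 0 < t := by
      have : ∀ᵐ t ∂(expMeasure (q / τ₀)), t ∉ Set.Iic (0 : ℝ) :=
        measure_eq_zero_iff_ae_notMem.mp (expMeasure_nonpos _)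
      filter_upwards [this] with t ht
      exact not_le.mp ht
    rw [← (hrace.attacker_law 0).map_eq] at h
    exact ae_of_ae_map (hrace.attacker_law 0).aemeasurable h
  have hpos : ∀ᵐ ω ∂μ, 0 < cycleDuration A z X Y ω := by
    filter_upwards [hY, ae_nonempty_endingTimes (A := A) (z := z) hq0 hq hp hτ₀ hrace] with ω h1 h2
    refine lt_of_lt_of_le (b := launchTime Y ω) ?_ (le_csInf h2 fun t ht => ht.1)
    simpa [launchTime, discoveryTime] using h1
  rw [integral_pos_iff_support_of_nonneg_ae (hpos.mono fun ω h => h.le)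
    (integral_cycleDuration hq0 hq hp hlam hτ₀ hz hA hrace).1]
  have hsupp : Function.support (cycleDuration A z X Y) =ᵐ[μ] Set.univ := by
    filter_upwards [hpos] with ω h
    exact eq_true h.ne'
  rw [measure_congr hsupp, measure_univ]
  exact one_pos

open Classical in
lemma successProb_eq_integral [IsFiniteMeasure μ]
    (h : Integrable (fun ω => if IsSuccess A z X Y ω then (1 : ℝ) else 0) μ) :
    successProb μ A z X Y = ∫ ω, (if IsSuccess A z X Y ω then (1 : ℝ) else 0) ∂μ := by
  -- Measurability of the success event is recovered from that of its integrable indicator, as the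
  -- preimage of `1`.
  have hm : NullMeasurableSet {ω | IsSuccess A z X Y ω} μ := by
    have h1 := h.aemeasurable.nullMeasurableSet_preimage (measurableSet_singleton (1 : ℝ))
    convert h1 using 1
    ext ω
    by_cases hs : IsSuccess A z X Y ω <;> simp [hs]
  have h2 : (fun ω => if IsSuccess A z X Y ω then (1 : ℝ) else 0) =
      {ω | IsSuccess A z X Y ω}.indicator fun _ => 1 := by
    funext ω
    by_cases hs : IsSuccess A z X Y ω <;> simp [hs]
  rw [h2, integral_indicator₀ hm]
  simp [successProb]

/-- The second value is the complement of the first, since `1 - 4pq = (p - q)^2`. -/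
lemma regIncBeta_half {q : ℝ} (hq0 : 0 < q) (hq : q < 1 / 2) (hp : p = 1 - q) (hz : 1 ≤ z) :
    regIncBeta (4 * p * q) z (1 / 2) = 2 * negBinSum z z q p ∧
      regIncBeta ((p - q) ^ 2) (1 / 2) z = 1 - 2 * negBinSum z z q p := by
  have h1 := regIncBeta_eq_negBinSum hz hq0 hq
  have hpq : 4 * (1 - q) * q ≤ 1 := by nlinarith [sq_nonneg (1 - 2 * q)]
  have h2 := regIncBeta_add_regIncBeta (a := (z : ℝ)) (b := 1 / 2) (by exact_mod_cast hz)
    one_half_pos (by nlinarith : 0 ≤ 4 * (1 - q) * q) hpq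
  rw [h1, show 1 - 4 * (1 - q) * q = ((1 - q) - q) ^ 2 by ring] at h2
  rw [hp]
  exact ⟨h1, by linarith⟩

end Revenue

end Nakamoto

theorem theorem2 {Ω : Type*} [MeasurableSpace Ω] (μ : Measure Ω) [IsProbabilityMeasure μ]
    (p q lam τ₀ b v : ℝ) (hq0 : 0 < q) (hq : q < 1 / 2) (hp : p = 1 - q) (hlam : lam = q / p)
    (hτ₀ : 0 < τ₀) (hb : 0 < b) (z A : ℕ) (hz : 1 ≤ z) (hA : z ≤ A)
    (X Y : ℕ → Ω → ℝ) (hrace : Nakamoto.IsMiningRace μ p q τ₀ X Y) :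
    -- the attack cycle ends almost surely, and its revenue and its duration are integrable
    (∀ᵐ ω ∂μ, (Nakamoto.endingTimes A z X Y ω).Nonempty) ∧
    Integrable (Nakamoto.revenue A z v b X Y) μ ∧
    Integrable (Nakamoto.cycleDuration A z X Y) μ ∧
    -- the probability of success
    Nakamoto.successProb μ A z X Y =
      (regIncBeta (4 * p * q) z (1 / 2) - lam ^ (A + 1)) / (1 - lam ^ (A + 1)) ∧
    -- the expected revenue
    (∫ ω, Nakamoto.revenue A z v b X Y ω ∂μ) / b =
      q * z / (2 * p) * regIncBeta (4 * p * q) z (1 / 2)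
        - (A + 1) * lam ^ (A + 1) / (p * (1 - lam) ^ 3 * lamBracket lam (A + 1) ^ 2)
          * regIncBeta ((p - q) ^ 2) (1 / 2) z
        + (2 - lam + lam ^ (A + 2)) / ((1 - lam) ^ 2 * lamBracket lam (A + 1))
          * (p ^ (z - 1) * q ^ z / beta z z)
        + Nakamoto.successProb μ A z X Y * (v / b + 1) ∧
    -- the expected duration
    (∫ ω, Nakamoto.cycleDuration A z X Y ω ∂μ) / τ₀ =
      z / (2 * p) * regIncBeta (4 * p * q) z (1 / 2)
        + (A + 1) / (p * (1 - lam) ^ 2 * lamBracket lam (A + 1))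
          * regIncBeta ((p - q) ^ 2) (1 / 2) z
        - p ^ (z - 1) * q ^ z / (p * (1 - lam) * beta z z)
        + 1 / q ∧
    -- the revenue ratio
    0 < ∫ ω, Nakamoto.cycleDuration A z X Y ω ∂μ ∧
    Nakamoto.revenueRatio μ A z v b X Y =
      b / τ₀ *
        ((q * z / (2 * p) * regIncBeta (4 * p * q) z (1 / 2)
            - (A + 1) * lam ^ (A + 1) / (p * (1 - lam) ^ 3 * lamBracket lam (A + 1) ^ 2)
              * regIncBeta ((p - q) ^ 2) (1 / 2) z
            + (2 - lam + lam ^ (A + 2)) / ((1 - lam) ^ 2 * lamBracket lam (A + 1))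
              * (p ^ (z - 1) * q ^ z / beta z z)
            + Nakamoto.successProb μ A z X Y * (v / b + 1)) /
          (z / (2 * p) * regIncBeta (4 * p * q) z (1 / 2)
            + (A + 1) / (p * (1 - lam) ^ 2 * lamBracket lam (A + 1))
              * regIncBeta ((p - q) ^ 2) (1 / 2) z
            - p ^ (z - 1) * q ^ z / (p * (1 - lam) * beta z z)
            + 1 / q)) := by
  obtain ⟨hs1, hs2⟩ := Nakamoto.integral_success hq0 hq hp hlam hτ₀ hz hA hrace
  obtain ⟨hf1, hf2⟩ := Nakamoto.integral_fork hq0 hq hp hlam hτ₀ hz hA hrace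
  obtain ⟨ht1, ht2⟩ := Nakamoto.integral_cycleDuration hq0 hq hp hlam hτ₀ hz hA hrace
  obtain ⟨hI, hI'⟩ := Nakamoto.regIncBeta_half hq0 hq hp hz
  have hP := (Nakamoto.successProb_eq_integral hs1).trans hs2
  have hRint : Integrable (Nakamoto.revenue A z v b X Y) μ := by
    rw [funext Nakamoto.revenue_eq]
    exact (hs1.const_mul v).add (hf1.const_mul b)
  have hpos := Nakamoto.integral_cycleDuration_pos hq0 hq hp hlam hτ₀ hz hA hrace
  have hR : (∫ ω, Nakamoto.revenue A z v b X Y ω ∂μ) / b =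
      q * z / (2 * p) * regIncBeta (4 * p * q) z (1 / 2)
        - (A + 1) * lam ^ (A + 1) / (p * (1 - lam) ^ 3 * lamBracket lam (A + 1) ^ 2)
          * regIncBeta ((p - q) ^ 2) (1 / 2) z
        + (2 - lam + lam ^ (A + 2)) / ((1 - lam) ^ 2 * lamBracket lam (A + 1))
          * (p ^ (z - 1) * q ^ z / beta z z)
        + Nakamoto.successProb μ A z X Y * (v / b + 1) := by
    simp_rw [Nakamoto.revenue_eq]
    rw [integral_add (hs1.const_mul v) (hf1.const_mul b), integral_const_mul, integral_const_mul,
      ← Nakamoto.successProb_eq_integral hs1, hf2, ← hP, hI, hI', add_div, mul_div_cancel_left₀ _ hb.ne']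
    ring
  have hT : (∫ ω, Nakamoto.cycleDuration A z X Y ω ∂μ) / τ₀ =
      z / (2 * p) * regIncBeta (4 * p * q) z (1 / 2)
        + (A + 1) / (p * (1 - lam) ^ 2 * lamBracket lam (A + 1))
          * regIncBeta ((p - q) ^ 2) (1 / 2) z
        - p ^ (z - 1) * q ^ z / (p * (1 - lam) * beta z z)
        + 1 / q := by
    rw [ht2, hI, hI', mul_div_cancel_left₀ _ hτ₀.ne']
    ring
  refine ⟨Nakamoto.ae_nonempty_endingTimes hq0 hq hp hτ₀ hrace, hRint, ht1, by rw [hP, hI], hR, hT,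
    hpos, ?_⟩
  rw [← hR, ← hT, Nakamoto.revenueRatio]
  field_simp
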